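/- We work over $\mathbb C$. For a finite-dimensional vector space $V$ let $\mathbb PV$ be the projective space of lines in $V^\ast$, so that $S^\ast V$ is its homogeneous coordinate ring. For $X\subseteq\mathbb PV$ let $I(X)\subseteq S^\ast V$ be the ideal of polynomials vanishing on $X$ and $I(X)_d=I(X)\cap S^dV$. For a smooth point $z$ of $X$ and $k\ge 0$, the $k$-osculating space $\mathbb T^k_zX\subseteq\mathbb PV$ is the projective linear subspace spanned by all partial derivatives $\partial^\alpha\phi(0)\in V^\ast$, $|\alpha|\le k$, where $\phi:(\mathbb C^n,0)\to V^\ast\setminus\{0\}$ is a holomorphic lifting of a local parametrization of $X$ at $z$. For $q\geq1$ let $$\sigma_q\tau^kX=\overline{\bigcup_{(z_1,\ldots,z_q)}\langle\mathbb T^k_{z_1}X,\ldots,\mathbb T^k_{z_q}X\rangle}\subseteq\mathbb PV$$ (Zariski closure), the union being over all $q$-tuples of smooth points of $X$ for which the dimension of the linear span $\langle\mathbb T^k_{z_1}X,\ldots,\mathbb T^k_{z_q}X\rangle$ is maximal. Let $q\ge1$ and $k\ge0$ be integers, let $V_1,\ldots,V_{2k+2}$ be finite-dimensional complex vector spaces,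 and let $Y=\mathbb PV_1\times\cdots\times\mathbb PV_{2k+2}\subseteq\mathbb P(V_1\otimes\cdots\otimes V_{2k+2})$ be the Segre variety. Then $$I(\sigma_q\tau^kY)_{q+1}=\textstyle\bigwedge^{q+1}V_1\otimes\cdots\otimes\bigwedge^{q+1}V_{2k+2}$$ as $\mathrm{GL}(V_1)\times\cdots\times\mathrm{GL}(V_{2k+2})$-modules. More precisely, $I(\sigma_q\tau^kY)_{q+1}$ is a submodule of $S^{q+1}(V_1\otimes\cdots\otimes V_{2k+2})$ for this group, and it is the image of the canonical injective equivariant linear map $\bigwedge^{q+1}V_1\otimes\cdots\otimes\bigwedge^{q+1}V_{2k+2}\to S^{q+1}(V_1\otimes\cdots\otimes V_{2k+2})$ given by $$\bigotimes_{i=1}^{2k+2}(v_{i,0}\wedge\cdots\wedge v_{i,q})\longmapsto\sum_{s_1,\ldots,s_{2k+2}\in\mathfrak S_{q+1}}\Big(\prod_{i=1}^{2k+2}\operatorname{sgn}(s_i)\Big)\prod_{j=0}^{q}\big(v_{1,s_1(j)}\otimes\cdots\otimes v_{2k+2,s_{2k+2}(j)}\big).$$ -/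

import Mathlib

open scoped TensorProduct LinearAlgebra.Projectivization Topology

noncomputable section

namespace SecOsc

/-! ### Projective geometry in the projective space of lines of the dual space

For a finite-dimensional complex vector space `V`, the points of the projective space attached to
`V` are the lines of the dual space of `V`, so `V` is the space of linear forms, and the
homogeneous coordinate ring is the symmetric algebra of `V`. -/

section Projective

universe u

variable {V : Type u} [AddCommGroup V] [Module ℂ V]

/-- The value of a polynomial function `f` (an element of the symmetric algebra of `V`) at a
vector `p` of the dual space. -/
def evalAt (p : Module.Dual ℂ V) : SymmetricAlgebra ℂ V →ₐ[ℂ] ℂ :=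
  SymmetricAlgebra.lift p

/-- The affine cone of `X`, including the origin. -/
def affineCone (X : Set (ℙ ℂ (Module.Dual ℂ V))) : Set (Module.Dual ℂ V) :=
  {p | ∀ hp : p ≠ 0, Projectivization.mk ℂ p hp ∈ X}

/-- The ideal `I(X)` of all polynomials that vanish on every representative of every point
of `X`. -/
def idealOf (X : Set (ℙ ℂ (Module.Dual ℂ V))) : Ideal (SymmetricAlgebra ℂ V) where
  carrier := {f | ∀ (p : Module.Dual ℂ V) (hp : p ≠ 0),
    Projectivization.mk ℂ p hp ∈ X → evalAt p f = 0}
  add_mem' := by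
    intro f g hf hg p hp hX
    rw [map_add, hf p hp hX, hg p hp hX, add_zero]
  zero_mem' := by
    intro p hp hX
    exact map_zero _
  smul_mem' := by
    intro c f hf p hp hX
    rw [smul_eq_mul, map_mul, hf p hp hX, mul_zero]

/-- The `d`-th symmetric power of `V`, as the degree `d` component of the symmetric algebra. -/
def symPower (V : Type u) [AddCommGroup V] [Module ℂ V] (d : ℕ) :
    Submodule ℂ (SymmetricAlgebra ℂ V) :=
  (LinearMap.range (SymmetricAlgebra.ι ℂ V)) ^ d

/-- The degree `d` component `I(X)_d` of the ideal of `X`. -/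
def idealComponent (X : Set (ℙ ℂ (Module.Dual ℂ V))) (d : ℕ) :
    Submodule ℂ (SymmetricAlgebra ℂ V) :=
  (idealOf X).restrictScalars ℂ ⊓ symPower V d

/-- The Zariski closure of `X`: the common zeros of all polynomials vanishing on `X`. -/
def zariskiClosure (X : Set (ℙ ℂ (Module.Dual ℂ V))) : Set (ℙ ℂ (Module.Dual ℂ V)) :=
  {z | ∀ f ∈ idealOf X, ∀ (p : Module.Dual ℂ V) (hp : p ≠ 0),
    Projectivization.mk ℂ p hp = z → evalAt p f = 0}

/-- The neighbourhoods of `p` in the dual of `V` for the topology of pointwise convergence on `V`;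
for finite-dimensional `V` this is the Euclidean topology. -/
def dualNhds (p : Module.Dual ℂ V) : Filter (Module.Dual ℂ V) :=
  Filter.comap (fun f : Module.Dual ℂ V => (f : V → ℂ)) (𝓝 (p : V → ℂ))

/-- `φ` is (near the origin of `ℂ^n`) a holomorphic lifting to the affine cone of a local
parametrization of the germ of `X` at `z`. For finite-dimensional `V`, holomorphy can be tested
after evaluation at each `v : V`. The condition `immersion` says that `φ(0), ∂₁φ(0), …, ∂ₙφ(0)` are
linearly independent, i.e. that `t ↦ [φ(t)]` is an immersion at the origin, and `onto` says that
its image is a whole neighbourhood of `z` in `X`. -/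
structure IsLocalParam (X : Set (ℙ ℂ (Module.Dual ℂ V))) (z : ℙ ℂ (Module.Dual ℂ V)) {n : ℕ}
    (φ : (Fin n → ℂ) → Module.Dual ℂ V) : Prop where
  analytic : ∀ v : V, AnalyticAt ℂ (fun t => φ t v) 0
  base : ∃ h : φ 0 ≠ 0, Projectivization.mk ℂ (φ 0) h = z
  mem_cone : ∀ᶠ t in 𝓝 (0 : Fin n → ℂ), φ t ∈ affineCone X
  immersion : LinearIndependent ℂ
    (Fin.cons (fun v => φ 0 v)
      (fun i v => fderiv ℂ (fun t => φ t v) 0 (Pi.single i 1)) : Fin (n + 1) → V → ℂ)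
  onto : ∀ N ∈ 𝓝 (0 : Fin n → ℂ), ∀ᶠ p in dualNhds (φ 0),
    p ∈ affineCone X → ∃ t ∈ N, ∃ c : ℂ, p = c • φ t

/-- The smooth locus of `X`: the points at which the germ of `X` is a complex submanifold. -/
def smoothLocus (X : Set (ℙ ℂ (Module.Dual ℂ V))) : Set (ℙ ℂ (Module.Dual ℂ V)) :=
  {z | z ∈ X ∧ ∃ (n : ℕ) (φ : (Fin n → ℂ) → Module.Dual ℂ V), IsLocalParam X z φ}

/-- The linear subspace of the dual space whose projectivization is the projective `k`-osculating
space to `X` at `z`: it is spanned by all partial derivatives at `0` of order at most `k` of (the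
lifting of) a local parametrization `φ` at `z`. The span does not depend on `φ`, and so all `φ` are
allowed here. The vector `p` below is the partial derivative
`∂_{w 0} ⋯ ∂_{w (j-1)} φ (0)`, computed by evaluating at every `v : V`. -/
def osculatingSpace (k : ℕ) (X : Set (ℙ ℂ (Module.Dual ℂ V))) (z : ℙ ℂ (Module.Dual ℂ V)) :
    Submodule ℂ (Module.Dual ℂ V) :=
  Submodule.span ℂ {p | ∃ (n : ℕ) (φ : (Fin n → ℂ) → Module.Dual ℂ V), IsLocalParam X z φ ∧
    ∃ (j : ℕ) (w : Fin j → Fin n), j ≤ k ∧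
      ∀ v : V, p v = iteratedFDeriv ℂ j (fun t => φ t v) 0 (fun a => Pi.single (w a) 1)}

/-- The linear span of the `k`-osculating spaces to `X` at the points `z 0, …, z (q-1)`. -/
def osculatingSpan (k : ℕ) (X : Set (ℙ ℂ (Module.Dual ℂ V))) {q : ℕ}
    (z : Fin q → ℙ ℂ (Module.Dual ℂ V)) : Submodule ℂ (Module.Dual ℂ V) :=
  ⨆ a, osculatingSpace k X (z a)

/-- A `q`-tuple of smooth points of `X` for which the dimension of the span of the `k`-osculating
spaces attains its maximum. -/
def IsGeneralTuple (k : ℕ) (X : Set (ℙ ℂ (Module.Dual ℂ V))) {q : ℕ}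
    (z : Fin q → ℙ ℂ (Module.Dual ℂ V)) : Prop :=
  (∀ a, z a ∈ smoothLocus X) ∧
    ∀ z' : Fin q → ℙ ℂ (Module.Dual ℂ V), (∀ a, z' a ∈ smoothLocus X) →
      Module.finrank ℂ (osculatingSpan k X z') ≤ Module.finrank ℂ (osculatingSpan k X z)

/-- The `q`-secant variety `σ_q τ^k X` to the `k`-osculating variety to `X`. -/
def secantOsculating (q k : ℕ) (X : Set (ℙ ℂ (Module.Dual ℂ V))) :
    Set (ℙ ℂ (Module.Dual ℂ V)) :=
  zariskiClosure {x | ∃ z : Fin q → ℙ ℂ (Module.Dual ℂ V),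
    IsGeneralTuple k X z ∧ x.submodule ≤ osculatingSpan k X z}

end Projective

/-! ### Segre varieties and the group actions -/

section Segre

universe u

variable {m : ℕ} (V : Fin m → Type u) [∀ i, AddCommGroup (V i)] [∀ i, Module ℂ (V i)]

/-- The functional `ℓ₁ ⊗ ⋯ ⊗ ℓ_m` on `V₁ ⊗ ⋯ ⊗ V_m`. -/
def tensorFunctional (ℓ : ∀ i, Module.Dual ℂ (V i)) : Module.Dual ℂ (⨂[ℂ] i, V i) :=
  PiTensorProduct.dualDistrib (PiTensorProduct.tprod ℂ ℓ)

theorem tensorFunctional_ne_zero (ℓ : ∀ i, Module.Dual ℂ (V i)) (hℓ : ∀ i, ℓ i ≠ 0) :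
    tensorFunctional V ℓ ≠ 0 := by
  have h : ∀ i, ∃ v : V i, ℓ i v ≠ 0 := by
    intro i
    by_contra! hc
    exact hℓ i (LinearMap.ext hc)
  choose v hv using h
  intro h0
  have h1 := LinearMap.congr_fun h0 (PiTensorProduct.tprod ℂ v)
  rw [tensorFunctional, PiTensorProduct.dualDistrib_apply] at h1
  exact Finset.prod_ne_zero_iff.mpr (fun i _ => hv i) h1

/-- The Segre variety `ℙV₁ × ⋯ × ℙV_m ⊆ ℙ(V₁ ⊗ ⋯ ⊗ V_m)`. -/
def segreVariety : Set (ℙ ℂ (Module.Dual ℂ (⨂[ℂ] i, V i))) :=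
  {z | ∃ (ℓ : ∀ i, Module.Dual ℂ (V i)) (hℓ : ∀ i, ℓ i ≠ 0),
    z = Projectivization.mk ℂ (tensorFunctional V ℓ) (tensorFunctional_ne_zero V ℓ hℓ)}

/-- The group `GL(V₁) × ⋯ × GL(V_m)`. -/
abbrev GLProd : Type u := ∀ i, LinearMap.GeneralLinearGroup ℂ (V i)

/-- The natural representation of `GL(V₁) × ⋯ × GL(V_m)` on `⋀^d V₁ ⊗ ⋯ ⊗ ⋀^d V_m`. -/
def wedgeRep (d : ℕ) : Representation ℂ (GLProd V) (⨂[ℂ] i, ⋀[ℂ]^d (V i)) where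
  toFun g := PiTensorProduct.map fun i => exteriorPower.map d (g i : V i →ₗ[ℂ] V i)
  map_one' := by
    have h : (fun i => exteriorPower.map d (((1 : GLProd V) i : V i →ₗ[ℂ] V i)))
        = fun i => LinearMap.id := by
      funext i
      exact exteriorPower.map_id
    rw [h]
    exact PiTensorProduct.map_id
  map_mul' g h := by
    have h' : (fun i => exteriorPower.map d (((g * h : GLProd V) i : V i →ₗ[ℂ] V i)))
        = fun i => exteriorPower.map d (g i : V i →ₗ[ℂ] V i) ∘ₗ
          exteriorPower.map d (h i : V i →ₗ[ℂ] V i) := by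
      funext i
      exact exteriorPower.map_comp (h i : V i →ₗ[ℂ] V i) (g i : V i →ₗ[ℂ] V i)
    rw [h', Module.End.mul_eq_comp]
    exact PiTensorProduct.map_comp _ _

/-- The natural representation of `GL(V₁) × ⋯ × GL(V_m)` on the symmetric algebra of
`V₁ ⊗ ⋯ ⊗ V_m`, by algebra automorphisms. -/
def symRep : Representation ℂ (GLProd V) (SymmetricAlgebra ℂ (⨂[ℂ] i, V i)) where
  toFun g := (SymmetricAlgebra.lift (SymmetricAlgebra.ι ℂ (⨂[ℂ] i, V i) ∘ₗ
    PiTensorProduct.map fun i => (g i : V i →ₗ[ℂ] V i))).toLinearMap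
  map_one' := by
    have h : (PiTensorProduct.map fun i => (((1 : GLProd V) i : V i →ₗ[ℂ] V i)))
        = LinearMap.id := PiTensorProduct.map_id
    rw [h, LinearMap.comp_id, SymmetricAlgebra.lift_ι]
    rfl
  map_mul' g h := by
    rw [Module.End.mul_eq_comp, ← AlgHom.comp_toLinearMap]
    congr 1
    apply SymmetricAlgebra.algHom_ext
    apply PiTensorProduct.ext
    ext v
    simp

end Segre

end SecOsc

end

noncomputable section
namespace SecOsc

/-! ### Polarization -/

section Polarization

universe u

variable {W : Type u} [AddCommGroup W] [Module ℂ W] {d : ℕ}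

theorem symPower_eq_span (d : ℕ) :
    symPower W d = Submodule.span ℂ
      (Set.range fun w : Fin d → W => ∏ j, SymmetricAlgebra.ι ℂ W (w j)) := by
  rw [symPower]
  induction d with
  | zero =>
    have : (Set.range fun w : Fin 0 → W => ∏ j, SymmetricAlgebra.ι ℂ W (w j)) = {1} := by
      ext x; simp
    rw [this, pow_zero, Submodule.one_eq_span]
  | succ d ih =>
    have h1 : LinearMap.range (SymmetricAlgebra.ι ℂ W) =
        Submodule.span ℂ (Set.range (SymmetricAlgebra.ι ℂ W)) := by
      rw [← LinearMap.coe_range, Submodule.span_eq]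
    rw [pow_succ', ih, h1, Submodule.span_mul_span]
    congr 1
    ext x
    simp only [Set.mem_mul, Set.mem_range, exists_exists_eq_and]
    constructor
    · rintro ⟨w, w', rfl⟩
      exact ⟨Fin.cons w w', by simp [Fin.prod_univ_succ]⟩
    · rintro ⟨w, rfl⟩
      exact ⟨w 0, fun j => w j.succ, by simp [Fin.prod_univ_succ]⟩

/-- The element of `ℂ[X₁, …, X_d]` obtained by evaluating `f` at `∑ X_j x_j`. -/
def evalGeneric (x : Fin d → Module.Dual ℂ W) :
    SymmetricAlgebra ℂ W →ₐ[ℂ] MvPolynomial (Fin d) ℂ :=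
  SymmetricAlgebra.lift (∑ j, (x j).smulRight (MvPolynomial.X j))

/-- The complete polarization of a form of degree `d`. -/
def polar (x : Fin d → Module.Dual ℂ W) : SymmetricAlgebra ℂ W →ₗ[ℂ] ℂ :=
  MvPolynomial.lcoeff ℂ (Finsupp.equivFunOnFinite.symm fun _ => 1) ∘ₗ (evalGeneric x).toLinearMap

theorem eval_evalGeneric (x : Fin d → Module.Dual ℂ W) (c : Fin d → ℂ)
    (f : SymmetricAlgebra ℂ W) :
    MvPolynomial.eval c (evalGeneric x f) = evalAt (∑ j, c j • x j) f := by
  suffices h : (MvPolynomial.aeval c).comp (evalGeneric x) = evalAt (∑ j, c j • x j) by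
    have := DFunLike.congr_fun h f
    simpa [MvPolynomial.aeval_eq_eval] using this
  apply SymmetricAlgebra.algHom_ext
  ext w
  simp [evalGeneric, evalAt, mul_comm]

theorem polar_eq_zero (x : Fin d → Module.Dual ℂ W) (f : SymmetricAlgebra ℂ W)
    (h : ∀ c : Fin d → ℂ, evalAt (∑ j, c j • x j) f = 0) : polar x f = 0 := by
  have : evalGeneric x f = 0 := MvPolynomial.funext fun c => by
    rw [eval_evalGeneric, h, map_zero]
  simp [polar, this]

theorem polar_prod (x : Fin d → Module.Dual ℂ W) (w : Fin d → W) :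
    polar x (∏ j, SymmetricAlgebra.ι ℂ W (w j)) =
      ∑ σ : Equiv.Perm (Fin d), ∏ j, x (σ j) (w j) := by
  classical
  have h1 : evalGeneric x (∏ j, SymmetricAlgebra.ι ℂ W (w j)) =
      ∑ τ : Fin d → Fin d, MvPolynomial.monomial (∑ j, Finsupp.single (τ j) 1)
        (∏ j, x (τ j) (w j)) := by
    simp only [map_prod, evalGeneric, SymmetricAlgebra.lift_ι_apply, LinearMap.sum_apply,
      LinearMap.smulRight_apply, Finset.prod_univ_sum, Fintype.piFinset_univ]
    refine Finset.sum_congr rfl fun τ _ => ?_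
    rw [MvPolynomial.monomial_sum_index]
    simp_rw [MvPolynomial.smul_eq_C_mul, Finset.prod_mul_distrib, map_prod]
    rfl
  have h2 : ∀ τ : Fin d → Fin d, (∑ j, Finsupp.single (τ j) 1 =
      (Finsupp.equivFunOnFinite.symm fun _ => 1 : Fin d →₀ ℕ)) ↔ Function.Bijective τ := by
    intro τ
    rw [← Finite.surjective_iff_bijective]
    have h3 : ∀ a, (∑ j, Finsupp.single (τ j) 1 : Fin d →₀ ℕ) a =
        (Finset.univ.filter fun j => τ j = a).card := by
      intro a
      simp [Finsupp.finsetSum_apply, Finsupp.single_apply]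
    constructor
    · intro h a
      have h4 := h3 a
      rw [h] at h4
      have : (Finset.univ.filter fun j => τ j = a).Nonempty := by
        rw [← Finset.card_pos, ← h4]
        simp
      obtain ⟨j, hj⟩ := this
      exact ⟨j, (Finset.mem_filter.mp hj).2⟩
    · intro h
      have hinj := Finite.injective_iff_surjective.mpr h
      ext a
      rw [h3]
      obtain ⟨j, rfl⟩ := h a
      simp [hinj.eq_iff, Finset.filter_eq']
  rw [polar, LinearMap.comp_apply, AlgHom.toLinearMap_apply, h1]
  simp only [map_sum, MvPolynomial.lcoeff_apply, MvPolynomial.coeff_monomial, h2]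
  rw [← Finset.sum_filter]
  symm
  refine Finset.sum_bij (fun σ _ => (σ : Fin d → Fin d)) ?_ ?_ ?_ ?_
  · intro σ _
    exact Finset.mem_filter.mpr ⟨Finset.mem_univ _, σ.bijective⟩
  · intro σ _ τ _ h
    exact DFunLike.coe_injective h
  · intro τ hτ
    exact ⟨Equiv.ofBijective τ (Finset.mem_filter.mp hτ).2, Finset.mem_univ _, rfl⟩
  · intro σ _
    rfl

end Polarization

/-! ### The canonical map and its inverse up to a scalar, in coordinates -/

section Canonical

theorem sum_sign_prod_eq_prod_det {m d : ℕ} (F : Fin m → Fin d → Fin d → ℂ) :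
    ∑ s : Fin m → Equiv.Perm (Fin d), (∏ i, ((Equiv.Perm.sign (s i) : ℤˣ) : ℤ) : ℤ) *
      ∏ j, ∏ i, F i (s i j) j = ∏ i, (Matrix.of (F i)).det := by
  classical
  simp_rw [Matrix.det_apply, Finset.prod_univ_sum, Fintype.piFinset_univ]
  refine Finset.sum_congr rfl fun s _ => ?_
  rw [Finset.prod_comm (s := Finset.univ (α := Fin d))]
  simp only [Units.smul_def, zsmul_eq_mul, Finset.prod_mul_distrib, Int.cast_prod, Matrix.of_apply]

universe u

variable {m d : ℕ} {V : Fin m → Type u} [∀ i, AddCommGroup (V i)] [∀ i, Module ℂ (V i)]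
  {κ : Fin m → Type} [∀ i, Fintype (κ i)] (b : ∀ i, Module.Basis (κ i) ℂ (V i))

theorem tprod_eq_sum_basis (u : ∀ i, V i) :
    PiTensorProduct.tprod ℂ u = ∑ r : ∀ i, κ i, (∏ i, (b i).coord (r i) (u i)) •
      PiTensorProduct.tprod ℂ fun i => b i (r i) := by
  classical
  have h : u = fun i => ∑ a, (b i).coord a (u i) • b i a := by
    funext i
    exact ((b i).sum_repr (u i)).symm
  conv_lhs => rw [h]
  rw [MultilinearMap.map_sum]
  refine Finset.sum_congr rfl fun r _ => ?_
  exact MultilinearMap.map_smul_univ _ _ _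

theorem prod_tprod_eq_sum_basis (u : Fin d → ∀ i, V i) :
    ∏ j, SymmetricAlgebra.ι ℂ _ (PiTensorProduct.tprod ℂ (u j)) =
      ∑ J : Fin d → ∀ i, κ i, (∏ j, ∏ i, (b i).coord (J j i) (u j i)) •
        ∏ j, SymmetricAlgebra.ι ℂ _ (PiTensorProduct.tprod ℂ fun i => b i (J j i)) := by
  classical
  simp_rw [tprod_eq_sum_basis b (u _), map_sum, Finset.prod_univ_sum, Fintype.piFinset_univ,
    map_smul, Finset.prod_smul]

/-- The functional on `⋀^d V₁ ⊗ ⋯ ⊗ ⋀^d V_m` which is the tensor product of the determinants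
attached to `d` coordinates on each factor. -/
def wedgeCoeff (J : Fin d → ∀ i, κ i) : Module.Dual ℂ (⨂[ℂ] i, ⋀[ℂ]^d (V i)) :=
  PiTensorProduct.dualDistrib (PiTensorProduct.tprod ℂ fun i =>
    exteriorPower.alternatingMapToDual ℂ (V i) d fun j => (b i).coord (J j i))

omit [∀ i, Fintype (κ i)] in
theorem wedgeCoeff_tprod (J : Fin d → ∀ i, κ i) (v : ∀ i, Fin d → V i) :
    wedgeCoeff b J (PiTensorProduct.tprod ℂ fun i => exteriorPower.ιMulti ℂ d (v i)) =
      ∑ s : Fin m → Equiv.Perm (Fin d), (∏ i, ((Equiv.Perm.sign (s i) : ℤˣ) : ℤ)) •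
        ∏ j, ∏ i, (b i).coord (J j i) (v i (s i j)) := by
  rw [wedgeCoeff, PiTensorProduct.dualDistrib_apply]
  simp_rw [exteriorPower.alternatingMapToDual_apply_ιMulti, zsmul_eq_mul]
  exact (sum_sign_prod_eq_prod_det fun i j j' => (b i).coord (J j' i) (v i j)).symm

/-- The canonical map `⋀^d V₁ ⊗ ⋯ ⊗ ⋀^d V_m → S^d (V₁ ⊗ ⋯ ⊗ V_m)`, in coordinates. -/
def wedgeToSym : (⨂[ℂ] i, ⋀[ℂ]^d (V i)) →ₗ[ℂ] SymmetricAlgebra ℂ (⨂[ℂ] i, V i) :=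
  ∑ J : Fin d → ∀ i, κ i, (wedgeCoeff b J).smulRight
    (∏ j, SymmetricAlgebra.ι ℂ _ (PiTensorProduct.tprod ℂ fun i => b i (J j i)))

theorem wedgeToSym_apply (x : ⨂[ℂ] i, ⋀[ℂ]^d (V i)) :
    wedgeToSym b x = ∑ J : Fin d → ∀ i, κ i, wedgeCoeff b J x •
      ∏ j, SymmetricAlgebra.ι ℂ _ (PiTensorProduct.tprod ℂ fun i => b i (J j i)) := by
  simp [wedgeToSym]

theorem wedgeToSym_tprod (v : ∀ i, Fin d → V i) :
    wedgeToSym b (PiTensorProduct.tprod ℂ fun i => exteriorPower.ιMulti ℂ d (v i)) =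
      ∑ s : Fin m → Equiv.Perm (Fin d), (∏ i, ((Equiv.Perm.sign (s i) : ℤˣ) : ℤ)) •
        ∏ j, SymmetricAlgebra.ι ℂ (⨂[ℂ] i, V i)
          (PiTensorProduct.tprod ℂ fun i => v i (s i j)) := by
  simp_rw [wedgeToSym_apply, wedgeCoeff_tprod, Finset.sum_smul]
  rw [Finset.sum_comm]
  refine Finset.sum_congr rfl fun s _ => ?_
  rw [prod_tprod_eq_sum_basis b, Finset.smul_sum]
  simp_rw [smul_assoc]

theorem wedge_linearMap_ext {N : Type*} [AddCommMonoid N] [Module ℂ N]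
    {f g : (⨂[ℂ] i, ⋀[ℂ]^d (V i)) →ₗ[ℂ] N}
    (h : ∀ v : ∀ i, Fin d → V i,
      f (PiTensorProduct.tprod ℂ fun i => exteriorPower.ιMulti ℂ d (v i)) =
        g (PiTensorProduct.tprod ℂ fun i => exteriorPower.ιMulti ℂ d (v i))) : f = g :=
  PiTensorProduct.ext_of_span_eq_top (g := fun i (a : Fin d → V i) => exteriorPower.ιMulti ℂ d a)
    (fun i => exteriorPower.ιMulti_span ℂ d (V i)) h

theorem wedgeToSym_wedgeRep (g : GLProd V) (x : ⨂[ℂ] i, ⋀[ℂ]^d (V i)) :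
    wedgeToSym b (wedgeRep V d g x) = symRep V g (wedgeToSym b x) := by
  suffices h : wedgeToSym b ∘ₗ wedgeRep V d g = symRep V g ∘ₗ wedgeToSym b from
    LinearMap.congr_fun h x
  refine wedge_linearMap_ext fun v => ?_
  have h1 : wedgeRep V d g (PiTensorProduct.tprod ℂ fun i => exteriorPower.ιMulti ℂ d (v i)) =
      PiTensorProduct.tprod ℂ fun i => exteriorPower.ιMulti ℂ d
        (fun j => (g i : V i →ₗ[ℂ] V i) (v i j)) := by
    simp only [wedgeRep, MonoidHom.coe_mk, OneHom.coe_mk, PiTensorProduct.map_tprod,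
      exteriorPower.map_apply_ιMulti]
    rfl
  rw [LinearMap.comp_apply, LinearMap.comp_apply, h1, wedgeToSym_tprod, wedgeToSym_tprod, map_sum]
  refine Finset.sum_congr rfl fun s _ => ?_
  rw [map_zsmul]
  congr 1
  simp [symRep, map_prod]

theorem wedgeToSym_mem_symPower (x : ⨂[ℂ] i, ⋀[ℂ]^d (V i)) :
    wedgeToSym b x ∈ symPower (⨂[ℂ] i, V i) d := by
  rw [wedgeToSym_apply, symPower_eq_span]
  exact Submodule.sum_mem _ fun J _ =>
    Submodule.smul_mem _ _ (Submodule.subset_span ⟨_, rfl⟩)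

end Canonical

/-! ### Column-alternating functions -/

section ColumnSigns

variable {m d : ℕ} {D : Fin m → Type*} [∀ i, AddCommGroup (D i)]

/-- Apply the permutation `σ` to the rows of `ℓ` in the columns that belong to `S`. -/
def permuteColumns (σ : Equiv.Perm (Fin d)) (S : Finset (Fin m)) (ℓ : Fin d → ∀ i, D i) :
    Fin d → ∀ i, D i :=
  fun j i => if i ∈ S then ℓ (σ j) i else ℓ j i

theorem add_swap_eq_zero {A B : Type*} [AddCommGroup A] [AddCommGroup B] (Q : A → A → B)
    (h₁ : ∀ x x' y, Q (x + x') y = Q x y + Q x' y) (h₂ : ∀ x y y', Q x (y + y') = Q x y + Q x y')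
    (h : ∀ x, Q x x = 0) (x y : A) : Q x y + Q y x = 0 := by
  have := h (x + y)
  rw [h₁, h₂, h₂, h, h, zero_add, add_zero] at this
  exact this

/-- A function of a matrix of vectors is additive in each entry. -/
def IsMultiadditive (G : (Fin d → ∀ i, D i) → ℂ) : Prop :=
  ∀ (j : Fin d) (i : Fin m) (ℓ ℓ₁ ℓ₂ : Fin d → ∀ i, D i),
    (∀ j' i', (j' ≠ j ∨ i' ≠ i) → ℓ₁ j' i' = ℓ j' i' ∧ ℓ₂ j' i' = ℓ j' i') →
    ℓ j i = ℓ₁ j i + ℓ₂ j i → G ℓ = G ℓ₁ + G ℓ₂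

variable {G : (Fin d → ∀ i, D i) → ℂ} (hadd : IsMultiadditive G)
  (hperm : ∀ (σ : Equiv.Perm (Fin d)) ℓ, G (fun j => ℓ (σ j)) = G ℓ)
  (hvan : ∀ (a b : Fin d) (i i' : Fin m) ℓ, a ≠ b → i ≠ i' → ℓ a i = ℓ b i → ℓ a i' = ℓ b i' →
    G ℓ = 0)

include hadd hvan in
theorem sum_swap_two_columns {a b : Fin d} (hab : a ≠ b) {i i' : Fin m} (hi : i ≠ i')
    (ℓ : Fin d → ∀ i, D i) :
    G ℓ + G (permuteColumns (Equiv.swap a b) {i} ℓ) +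
      (G (permuteColumns (Equiv.swap a b) {i'} ℓ) +
        G (permuteColumns (Equiv.swap a b) {i} (permuteColumns (Equiv.swap a b) {i'} ℓ))) = 0 := by
  classical
  let E : D i → D i → D i' → D i' → Fin d → ∀ i, D i := fun α β γ δ =>
    Function.update (Function.update ℓ
      a (Function.update (Function.update (ℓ a) i α) i' γ))
      b (Function.update (Function.update (ℓ b) i β) i' δ)
  have e1 : ∀ α β γ δ, E α β γ δ a i = α := by intros; simp [E, hab, hi]
  have e2 : ∀ α β γ δ, E α β γ δ b i = β := by intros; simp [E, hi]
  have e3 : ∀ α β γ δ, E α β γ δ a i' = γ := by intros; simp [E, hab]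
  have e4 : ∀ α β γ δ, E α β γ δ b i' = δ := by intros; simp [E]
  have e5 : ∀ α β γ δ c, c ≠ i → c ≠ i' → E α β γ δ a c = ℓ a c := by
    intro _ _ _ _ c h h'; simp [E, hab, h, h']
  have e6 : ∀ α β γ δ c, c ≠ i → c ≠ i' → E α β γ δ b c = ℓ b c := by
    intro _ _ _ _ c h h'; simp [E, h, h']
  have e7 : ∀ α β γ δ r c, r ≠ a → r ≠ b → E α β γ δ r c = ℓ r c := by
    intro _ _ _ _ r c h h'; simp [E, h, h']
  have ext' : ∀ (ℓ' : Fin d → ∀ i, D i) α β γ δ, ℓ' a i = α → ℓ' b i = β → ℓ' a i' = γ →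
      ℓ' b i' = δ → (∀ c, c ≠ i → c ≠ i' → ℓ' a c = ℓ a c) →
      (∀ c, c ≠ i → c ≠ i' → ℓ' b c = ℓ b c) → (∀ r c, r ≠ a → r ≠ b → ℓ' r c = ℓ r c) →
      ℓ' = E α β γ δ := by
    intro ℓ' α β γ δ h1 h2 h3 h4 h5 h6 h7
    funext r c
    by_cases ha : r = a
    · subst ha
      by_cases hc : c = i
      · subst hc; rw [e1, h1]
      · by_cases hc' : c = i'
        · subst hc'; rw [e3, h3]
        · rw [e5 _ _ _ _ _ hc hc', h5 _ hc hc']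
    · by_cases hb : r = b
      · subst hb
        by_cases hc : c = i
        · subst hc; rw [e2, h2]
        · by_cases hc' : c = i'
          · subst hc'; rw [e4, h4]
          · rw [e6 _ _ _ _ _ hc hc', h6 _ hc hc']
      · rw [e7 _ _ _ _ _ _ ha hb, h7 _ _ ha hb]
  have a1 : ∀ α α' β γ δ, G (E (α + α') β γ δ) = G (E α β γ δ) + G (E α' β γ δ) := by
    intro α α' β γ δ
    refine hadd a i _ _ _ (fun r c hrc => ?_) (by simp only [e1])
    constructor <;> · simp only [E, Function.update_apply]; grind
  have a2 : ∀ α β β' γ δ, G (E α (β + β') γ δ) = G (E α β γ δ) + G (E α β' γ δ) := by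
    intro α α' β γ δ
    refine hadd b i _ _ _ (fun r c hrc => ?_) (by simp only [e2])
    constructor <;> · simp only [E, Function.update_apply]; grind
  have a3 : ∀ α β γ γ' δ, G (E α β (γ + γ') δ) = G (E α β γ δ) + G (E α β γ' δ) := by
    intro α α' β γ δ
    refine hadd a i' _ _ _ (fun r c hrc => ?_) (by simp only [e3])
    constructor <;> · simp only [E, Function.update_apply]; grind
  have a4 : ∀ α β γ δ δ', G (E α β γ (δ + δ')) = G (E α β γ δ) + G (E α β γ δ') := by
    intro α α' β γ δ
    refine hadd b i' _ _ _ (fun r c hrc => ?_) (by simp only [e4])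
    constructor <;> · simp only [E, Function.update_apply]; grind
  have key : ∀ α β γ δ, (G (E α β γ δ) + G (E β α γ δ)) + (G (E α β δ γ) + G (E β α δ γ)) = 0 := by
    intro α β
    refine add_swap_eq_zero (fun γ δ => G (E α β γ δ) + G (E β α γ δ)) ?_ ?_ ?_
    · intro γ γ' δ
      simp only [a3]; ring
    · intro γ δ δ'
      simp only [a4]; ring
    · intro γ
      refine add_swap_eq_zero (fun α β => G (E α β γ γ)) (fun _ _ _ => a1 _ _ _ _ _)
        (fun _ _ _ => a2 _ _ _ _ _) (fun α => ?_) α β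
      exact hvan a b i i' _ hab hi (by rw [e1, e2]) (by rw [e3, e4])
  have s1 : ℓ = E (ℓ a i) (ℓ b i) (ℓ a i') (ℓ b i') := by
    apply ext' <;> simp
  have sw : ∀ r, r ≠ a → r ≠ b → Equiv.swap a b r = r :=
    fun r => Equiv.swap_apply_of_ne_of_ne
  have s2 : permuteColumns (Equiv.swap a b) {i} ℓ = E (ℓ b i) (ℓ a i) (ℓ a i') (ℓ b i') := by
    apply ext' <;> simp +contextual [permuteColumns, hi.symm, sw]
  have s3 : permuteColumns (Equiv.swap a b) {i'} ℓ = E (ℓ a i) (ℓ b i) (ℓ b i') (ℓ a i') := by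
    apply ext' <;> simp +contextual [permuteColumns, hi, sw]
  have s4 : permuteColumns (Equiv.swap a b) {i} (permuteColumns (Equiv.swap a b) {i'} ℓ) =
      E (ℓ b i) (ℓ a i) (ℓ b i') (ℓ a i') := by
    apply ext' <;> simp +contextual [permuteColumns, hi, hi.symm, sw]
  rw [s4, s2, s3]
  nth_rewrite 1 [s1]
  exact key _ _ _ _

include hadd hperm hvan in
theorem swap_column (hm : Even m) {a b : Fin d} (hab : a ≠ b) (i : Fin m)
    (ℓ : Fin d → ∀ i, D i) :
    G (permuteColumns (Equiv.swap a b) {i} ℓ) = -G ℓ := by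
  classical
  have h1 : ∀ S : Finset (Fin m), i ∉ S → ∀ ℓ : Fin d → ∀ i, D i,
      G (permuteColumns (Equiv.swap a b) S ℓ) +
        G (permuteColumns (Equiv.swap a b) {i} (permuteColumns (Equiv.swap a b) S ℓ)) =
      (-1) ^ S.card * (G ℓ + G (permuteColumns (Equiv.swap a b) {i} ℓ)) := by
    intro S
    induction S using Finset.induction_on with
    | empty =>
      intro _ ℓ
      have : permuteColumns (Equiv.swap a b) ∅ ℓ = ℓ := by
        funext r c; simp [permuteColumns]
      simp [this]
    | insert c S hc ih =>
      intro hi ℓ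
      have hic : i ≠ c := fun h => hi (h ▸ Finset.mem_insert_self _ _)
      have hS : permuteColumns (Equiv.swap a b) (insert c S) ℓ =
          permuteColumns (Equiv.swap a b) {c} (permuteColumns (Equiv.swap a b) S ℓ) := by
        funext r e
        simp only [permuteColumns, Finset.mem_insert, Finset.mem_singleton]
        grind
      have h2 := sum_swap_two_columns hadd hvan hab hic (permuteColumns (Equiv.swap a b) S ℓ)
      rw [ih (fun h => hi (Finset.mem_insert_of_mem h))] at h2
      rw [hS, Finset.card_insert_of_notMem hc, pow_succ]
      linear_combination h2
  have h2 := h1 (Finset.univ.erase i) (Finset.notMem_erase _ _) ℓ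
  have h3 : permuteColumns (Equiv.swap a b) (Finset.univ.erase i) ℓ =
      fun j => permuteColumns (Equiv.swap a b) {i} ℓ (Equiv.swap a b j) := by
    funext r c
    simp only [permuteColumns, Finset.mem_erase, Finset.mem_univ, Finset.mem_singleton,
      Equiv.swap_apply_self]
    grind
  have h4 : permuteColumns (Equiv.swap a b) {i}
      (permuteColumns (Equiv.swap a b) (Finset.univ.erase i) ℓ) =
      fun j => ℓ (Equiv.swap a b j) := by
    funext r c
    simp only [permuteColumns, Finset.mem_erase, Finset.mem_univ, Finset.mem_singleton]
    grind
  have hmpos : 0 < m := i.pos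
  have h5 : Odd (Finset.univ.erase i).card := by
    rw [Finset.card_erase_of_mem (Finset.mem_univ _), Finset.card_univ, Fintype.card_fin]
    exact Nat.Even.sub_odd hmpos hm odd_one
  rw [h4, h3, hperm, hperm, h5.neg_one_pow] at h2
  linear_combination (1 / 2 : ℂ) * h2

include hadd hperm hvan in
/-- A multiadditive function of the entries of a matrix with an even number of columns that is
invariant under permutations of the rows and vanishes when two rows agree in two columns is
alternating in each column. -/
theorem column_signs (hm : Even m) (s : Fin m → Equiv.Perm (Fin d)) (ℓ : Fin d → ∀ i, D i) :
    G (fun j i => ℓ (s i j) i) = (∏ i, ((Equiv.Perm.sign (s i) : ℤˣ) : ℤ) : ℤ) * G ℓ := by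
  classical
  have h1 : ∀ (σ : Equiv.Perm (Fin d)) (i : Fin m) (ℓ : Fin d → ∀ i, D i),
      G (permuteColumns σ {i} ℓ) = ((Equiv.Perm.sign σ : ℤˣ) : ℤ) * G ℓ := by
    intro σ i
    induction σ using Equiv.Perm.swap_induction_on with
    | one =>
      intro ℓ
      have : permuteColumns 1 {i} ℓ = ℓ := by
        funext r c; simp [permuteColumns]
      simp [this]
    | swap_mul f x y hxy ih =>
      intro ℓ
      have : permuteColumns (Equiv.swap x y * f) {i} ℓ =
          permuteColumns f {i} (permuteColumns (Equiv.swap x y) {i} ℓ) := by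
        funext r c
        simp only [permuteColumns, Equiv.Perm.mul_apply]
        grind
      rw [this, ih, swap_column hadd hperm hvan hm hxy, Equiv.Perm.sign_mul,
        Equiv.Perm.sign_swap hxy]
      push_cast
      ring
  have h2 : ∀ (T : Finset (Fin m)) (ℓ : Fin d → ∀ i, D i),
      G (fun j i => if i ∈ T then ℓ (s i j) i else ℓ j i) =
        (∏ i ∈ T, ((Equiv.Perm.sign (s i) : ℤˣ) : ℤ) : ℤ) * G ℓ := by
    intro T
    induction T using Finset.induction_on with
    | empty => intro ℓ; simp
    | insert c T hc ih =>
      intro ℓ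
      have : (fun j i => if i ∈ insert c T then ℓ (s i j) i else ℓ j i) =
          fun j i => if i ∈ T then permuteColumns (s c) {c} ℓ (s i j) i
            else permuteColumns (s c) {c} ℓ j i := by
        funext j i
        simp only [permuteColumns, Finset.mem_insert, Finset.mem_singleton]
        grind
      rw [this, ih, h1, Finset.prod_insert hc]
      push_cast
      ring
  simpa using h2 Finset.univ ℓ

end ColumnSigns

section PolarSymmetries

universe u

variable {W : Type u} [AddCommGroup W] [Module ℂ W] {d : ℕ}

theorem exists_multilinear_polar {f : SymmetricAlgebra ℂ W} (hf : f ∈ symPower W d) :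
    ∃ P : MultilinearMap ℂ (fun _ : Fin d => Module.Dual ℂ W) ℂ, ∀ x, P x = polar x f := by
  rw [symPower_eq_span] at hf
  induction hf using Submodule.span_induction with
  | mem f h =>
    obtain ⟨w, rfl⟩ := h
    refine ⟨∑ σ : Equiv.Perm (Fin d), (MultilinearMap.mkPiAlgebra ℂ (Fin d) ℂ).compLinearMap
      fun j => Module.Dual.eval ℂ W (w (σ.symm j)), fun x => ?_⟩
    simp only [polar_prod, sum_apply, MultilinearMap.compLinearMap_apply,
      MultilinearMap.mkPiAlgebra_apply, Module.Dual.eval_apply]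
    refine Finset.sum_congr rfl fun σ _ => ?_
    rw [← Equiv.prod_comp σ]
    simp
  | zero => exact ⟨0, fun x => by simp⟩
  | add f g _ _ hf hg =>
    obtain ⟨P, hP⟩ := hf
    obtain ⟨Q, hQ⟩ := hg
    exact ⟨P + Q, fun x => by simp [hP, hQ]⟩
  | smul c f _ hf =>
    obtain ⟨P, hP⟩ := hf
    exact ⟨c • P, fun x => by simp [hP]⟩

theorem polar_perm {f : SymmetricAlgebra ℂ W} (hf : f ∈ symPower W d) (τ : Equiv.Perm (Fin d))
    (x : Fin d → Module.Dual ℂ W) : polar (fun j => x (τ j)) f = polar x f := by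
  rw [symPower_eq_span] at hf
  induction hf using Submodule.span_induction with
  | mem f h =>
    obtain ⟨w, rfl⟩ := h
    simp only [polar_prod]
    exact Fintype.sum_equiv (Equiv.mulLeft τ) _ _ fun σ => rfl
  | zero => simp
  | add f g _ _ hf hg => rw [map_add, map_add, hf, hg]
  | smul c f _ hf => rw [map_smul, map_smul, hf]

theorem sum_polar_smul_prod {r : Type*} [Fintype r] (E : r → W) (ε : r → Module.Dual ℂ W)
    (h : ∀ w, w = ∑ a, ε a w • E a) {f : SymmetricAlgebra ℂ W} (hf : f ∈ symPower W d) :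
    ∑ J : Fin d → r, polar (fun j => ε (J j)) f • ∏ j, SymmetricAlgebra.ι ℂ W (E (J j)) =
      (d.factorial : ℂ) • f := by
  classical
  rw [symPower_eq_span] at hf
  induction hf using Submodule.span_induction with
  | mem f hf =>
    obtain ⟨w, rfl⟩ := hf
    have h1 : ∀ σ : Equiv.Perm (Fin d), ∑ J : Fin d → r, (∏ j, ε (J (σ j)) (w j)) •
        ∏ j, SymmetricAlgebra.ι ℂ W (E (J j)) = ∏ j, SymmetricAlgebra.ι ℂ W (w j) := by
      intro σ
      have h2 : ∏ j, SymmetricAlgebra.ι ℂ W (w j) =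
          ∏ j, ∑ a, ε a (w j) • SymmetricAlgebra.ι ℂ W (E a) := by
        refine Finset.prod_congr rfl fun j _ => ?_
        conv_lhs => rw [h (w j)]
        simp
      rw [h2, Finset.prod_univ_sum, Fintype.piFinset_univ]
      simp_rw [Finset.prod_smul]
      refine Fintype.sum_equiv (Equiv.arrowCongr σ.symm (Equiv.refl r)) _ _ fun J => ?_
      congr 1
      exact (Equiv.prod_comp σ (fun j => SymmetricAlgebra.ι ℂ W (E (J j)))).symm
    simp_rw [polar_prod, Finset.sum_smul]
    rw [Finset.sum_comm, Finset.sum_congr rfl fun σ _ => h1 σ, Finset.sum_const,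
      Finset.card_univ, Fintype.card_perm, Fintype.card_fin, Nat.cast_smul_eq_nsmul]
  | zero => simp
  | add f g _ _ hf hg =>
    rw [smul_add, ← hf, ← hg, ← Finset.sum_add_distrib]
    simp_rw [map_add, add_smul]
  | smul c f _ hf =>
    rw [smul_comm, ← hf, Finset.smul_sum]
    simp_rw [map_smul, smul_assoc]

end PolarSymmetries

section WedgeInverse

universe u

variable {m d : ℕ} {V : Fin m → Type u} [∀ i, AddCommGroup (V i)] [∀ i, Module ℂ (V i)]
  {κ : Fin m → Type} [∀ i, Fintype (κ i)] (b : ∀ i, Module.Basis (κ i) ℂ (V i))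

theorem tensorFunctional_tprod (ℓ : ∀ i, Module.Dual ℂ (V i)) (u : ∀ i, V i) :
    tensorFunctional V ℓ (PiTensorProduct.tprod ℂ u) = ∏ i, ℓ i (u i) :=
  PiTensorProduct.dualDistrib_apply _ _

theorem eq_sum_tensorFunctional_coord (w : ⨂[ℂ] i, V i) :
    w = ∑ r : ∀ i, κ i, tensorFunctional V (fun i => (b i).coord (r i)) w •
      PiTensorProduct.tprod ℂ fun i => b i (r i) := by
  suffices h : LinearMap.id = ∑ r : ∀ i, κ i,
      (tensorFunctional V fun i => (b i).coord (r i)).smulRight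
        (PiTensorProduct.tprod ℂ fun i => b i (r i)) by
    simpa using LinearMap.congr_fun h w
  refine PiTensorProduct.ext (MultilinearMap.ext fun u => ?_)
  simpa [tensorFunctional_tprod] using tprod_eq_sum_basis b u

theorem tprod_ιMulti_eq_sum_basis (u : ∀ i, Fin d → V i) :
    (PiTensorProduct.tprod ℂ fun i => exteriorPower.ιMulti ℂ d (u i)) =
      ∑ J : Fin d → ∀ i, κ i, (∏ j, ∏ i, (b i).coord (J j i) (u i j)) •
        PiTensorProduct.tprod ℂ fun i => exteriorPower.ιMulti ℂ d fun j => b i (J j i) := by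
  classical
  have h : ∀ i, exteriorPower.ιMulti ℂ d (u i) = ∑ r : Fin d → κ i,
      (∏ j, (b i).coord (r j) (u i j)) • exteriorPower.ιMulti ℂ d fun j => b i (r j) := by
    intro i
    have h1 : u i = fun j => ∑ a, (b i).coord a (u i j) • b i a := by
      funext j
      exact ((b i).sum_repr (u i j)).symm
    conv_lhs => rw [h1]
    change (exteriorPower.ιMulti ℂ d).toMultilinearMap _ = _
    rw [MultilinearMap.map_sum]
    refine Finset.sum_congr rfl fun r _ => ?_
    exact MultilinearMap.map_smul_univ _ _ _
  simp_rw [h]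
  rw [MultilinearMap.map_sum]
  refine Fintype.sum_equiv (Equiv.piComm _) _ _ fun R => ?_
  rw [MultilinearMap.map_smul_univ, Finset.prod_comm]
  rfl

/-- The map that is inverse to the canonical map on its image, up to a scalar. -/
def symToWedge : SymmetricAlgebra ℂ (⨂[ℂ] i, V i) →ₗ[ℂ] ⨂[ℂ] i, ⋀[ℂ]^d (V i) :=
  ∑ J : Fin d → ∀ i, κ i, (polar fun j => tensorFunctional V fun i => (b i).coord (J j i)).smulRight
    (PiTensorProduct.tprod ℂ fun i => exteriorPower.ιMulti ℂ d fun j => b i (J j i))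

theorem symToWedge_apply (f : SymmetricAlgebra ℂ (⨂[ℂ] i, V i)) :
    symToWedge (d := d) b f = ∑ J : Fin d → ∀ i, κ i,
      polar (fun j => tensorFunctional V fun i => (b i).coord (J j i)) f •
        PiTensorProduct.tprod ℂ fun i => exteriorPower.ιMulti ℂ d fun j => b i (J j i) := by
  simp [symToWedge]

theorem prod_sign_sq (s : Fin m → Equiv.Perm (Fin d)) :
    (∏ i, ((Equiv.Perm.sign (s i) : ℤˣ) : ℤ)) * ∏ i, ((Equiv.Perm.sign (s i) : ℤˣ) : ℤ) = 1 := by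
  rw [← Finset.prod_mul_distrib]
  exact Finset.prod_eq_one fun i _ => by rw [← Units.val_mul, Int.units_mul_self, Units.val_one]

theorem prod_sign_mul (hm : Even m) (s : Fin m → Equiv.Perm (Fin d)) (σ : Equiv.Perm (Fin d)) :
    ∏ i, ((Equiv.Perm.sign (s i * σ) : ℤˣ) : ℤ) = ∏ i, ((Equiv.Perm.sign (s i) : ℤˣ) : ℤ) := by
  simp_rw [Equiv.Perm.sign_mul, Units.val_mul, Finset.prod_mul_distrib]
  rw [Finset.prod_const, Finset.card_univ, Fintype.card_fin, ← Units.val_pow_eq_pow_val]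
  obtain ⟨n, rfl⟩ := hm
  rw [pow_add, Int.units_mul_self, Units.val_one, mul_one]

theorem polar_wedgeToSym (hm : Even m) (J : Fin d → ∀ i, κ i) (x : ⨂[ℂ] i, ⋀[ℂ]^d (V i)) :
    polar (fun j => tensorFunctional V fun i => (b i).coord (J j i)) (wedgeToSym b x) =
      (d.factorial : ℂ) * wedgeCoeff b J x := by
  suffices h : (polar fun j => tensorFunctional V fun i => (b i).coord (J j i)) ∘ₗ wedgeToSym b =
      (d.factorial : ℂ) • wedgeCoeff b J from LinearMap.congr_fun h x
  refine wedge_linearMap_ext fun v => ?_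
  rw [LinearMap.comp_apply, LinearMap.smul_apply, wedgeToSym_tprod, wedgeCoeff_tprod, map_sum]
  simp_rw [map_zsmul, polar_prod, tensorFunctional_tprod, Finset.smul_sum]
  rw [Finset.sum_comm]
  have h1 : ∀ σ : Equiv.Perm (Fin d), ∑ s : Fin m → Equiv.Perm (Fin d),
      (∏ i, ((Equiv.Perm.sign (s i) : ℤˣ) : ℤ)) •
        ∏ j, ∏ i, (b i).coord (J (σ j) i) (v i (s i j)) =
      ∑ s : Fin m → Equiv.Perm (Fin d), (∏ i, ((Equiv.Perm.sign (s i) : ℤˣ) : ℤ)) •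
        ∏ j, ∏ i, (b i).coord (J j i) (v i (s i j)) := by
    intro σ
    symm
    refine Fintype.sum_equiv (Equiv.piCongrRight fun _ => Equiv.mulRight σ) _ _ fun s => ?_
    simp only [Equiv.piCongrRight_apply, Pi.map_apply, Equiv.coe_mulRight, prod_sign_mul hm s σ]
    rw [← Equiv.prod_comp σ]
    rfl
  rw [Finset.sum_congr rfl fun σ _ => h1 σ, Finset.sum_const, Finset.card_univ, Fintype.card_perm,
    Fintype.card_fin, ← Nat.cast_smul_eq_nsmul ℂ, Finset.smul_sum]

theorem symToWedge_wedgeToSym (hm : Even m) (x : ⨂[ℂ] i, ⋀[ℂ]^d (V i)) :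
    symToWedge b (wedgeToSym b x) =
      ((d.factorial : ℂ) * (Fintype.card (Fin m → Equiv.Perm (Fin d)) : ℂ)) • x := by
  rw [symToWedge_apply]
  simp_rw [polar_wedgeToSym b hm, mul_smul]
  rw [← Finset.smul_sum]
  congr 1
  suffices h : ∑ J : Fin d → ∀ i, κ i, (wedgeCoeff b J).smulRight
      (PiTensorProduct.tprod ℂ fun i => exteriorPower.ιMulti ℂ d fun j => b i (J j i)) =
      (Fintype.card (Fin m → Equiv.Perm (Fin d)) : ℂ) • LinearMap.id by
    simpa using LinearMap.congr_fun h x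
  refine wedge_linearMap_ext fun v => ?_
  simp only [LinearMap.sum_apply, LinearMap.smulRight_apply, LinearMap.smul_apply,
    LinearMap.id_apply, wedgeCoeff_tprod, Finset.sum_smul]
  rw [Finset.sum_comm]
  have h1 : ∀ s : Fin m → Equiv.Perm (Fin d), ∑ J : Fin d → ∀ i, κ i,
      ((∏ i, ((Equiv.Perm.sign (s i) : ℤˣ) : ℤ)) •
        ∏ j, ∏ i, (b i).coord (J j i) (v i (s i j))) •
        (PiTensorProduct.tprod ℂ fun i => exteriorPower.ιMulti ℂ d fun j => b i (J j i)) =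
      PiTensorProduct.tprod ℂ fun i => exteriorPower.ιMulti ℂ d (v i) := by
    intro s
    simp_rw [zsmul_eq_mul, mul_smul]
    rw [← Finset.smul_sum, ← tprod_ιMulti_eq_sum_basis b fun i j => v i (s i j)]
    have h2 : ∀ i, exteriorPower.ιMulti ℂ d (fun j => v i (s i j)) =
        (((Equiv.Perm.sign (s i) : ℤˣ) : ℤ) : ℂ) • exteriorPower.ιMulti ℂ d (v i) := by
      intro i
      refine ((exteriorPower.ιMulti ℂ d).map_perm (v i) (s i)).trans ?_
      rcases Int.units_eq_one_or (Equiv.Perm.sign (s i)) with h | h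
      · simp [h]
      · rw [h]
        have h3 : (((-1 : ℤˣ) : ℤ) : ℂ) = -1 := by simp
        rw [h3]
        refine Eq.trans (b := -exteriorPower.ιMulti ℂ d (v i)) (by simp) ?_
        exact (neg_one_smul ℂ (exteriorPower.ιMulti ℂ d (v i))).symm
    rw [funext h2, MultilinearMap.map_smul_univ, ← Int.cast_prod, smul_smul, ← Int.cast_mul,
      prod_sign_sq, Int.cast_one, one_smul]
  rw [Finset.sum_congr rfl fun s _ => h1 s, Finset.sum_const, Finset.card_univ,
    Nat.cast_smul_eq_nsmul]

theorem wedgeToSym_injective (hm : Even m) :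
    Function.Injective (wedgeToSym (d := d) b) := by
  refine (injective_iff_map_eq_zero _).mpr fun x hx => ?_
  have h := symToWedge_wedgeToSym b hm x
  rw [hx, map_zero] at h
  refine (smul_eq_zero.mp h.symm).resolve_left (mul_ne_zero ?_ ?_)
  · exact_mod_cast d.factorial_ne_zero
  · exact_mod_cast Fintype.card_ne_zero

theorem mem_range_wedgeToSym {f : SymmetricAlgebra ℂ (⨂[ℂ] i, V i)}
    (hf : f ∈ symPower (⨂[ℂ] i, V i) d)
    (h : ∀ (s : Fin m → Equiv.Perm (Fin d)) (ℓ : Fin d → ∀ i, Module.Dual ℂ (V i)),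
      polar (fun j => tensorFunctional V fun i => ℓ (s i j) i) f =
        (∏ i, ((Equiv.Perm.sign (s i) : ℤˣ) : ℤ) : ℤ) * polar (fun j => tensorFunctional V (ℓ j)) f) :
    f ∈ LinearMap.range (wedgeToSym (d := d) b) := by
  have h0 : ∀ s : Fin m → Equiv.Perm (Fin d),
      ∑ J : Fin d → ∀ i, κ i, polar (fun j => tensorFunctional V fun i => (b i).coord (J j i)) f •
        ((∏ i, ((Equiv.Perm.sign (s i) : ℤˣ) : ℤ)) •
          ∏ j, SymmetricAlgebra.ι ℂ _ (PiTensorProduct.tprod ℂ fun i => b i (J (s i j) i))) =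
      (d.factorial : ℂ) • f := by
    intro s
    rw [← sum_polar_smul_prod _ _ (eq_sum_tensorFunctional_coord b) hf]
    let e : (Fin d → ∀ i, κ i) ≃ (Fin d → ∀ i, κ i) :=
      (Equiv.piComm _).trans ((Equiv.piCongrRight fun i =>
        Equiv.arrowCongr (s i).symm (Equiv.refl (κ i))).trans (Equiv.piComm _))
    have he : ∀ J j i, e J j i = J (s i j) i := fun _ _ _ => rfl
    refine Fintype.sum_equiv e _ _ fun J => ?_
    have h1 := h s fun j i => (b i).coord (J j i)
    simp only [he]
    rw [h1, mul_smul, smul_comm, ← Int.cast_smul_eq_zsmul ℂ]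
  have h1 : wedgeToSym b (symToWedge (d := d) b f) =
      ((Fintype.card (Fin m → Equiv.Perm (Fin d)) : ℂ) * (d.factorial : ℂ)) • f := by
    rw [symToWedge_apply, map_sum]
    simp_rw [map_smul, wedgeToSym_tprod, Finset.smul_sum]
    rw [Finset.sum_comm, Finset.sum_congr rfl fun s _ => h0 s, Finset.sum_const, Finset.card_univ,
      mul_smul, Nat.cast_smul_eq_nsmul ℂ (Fintype.card _)]
  have h2 : (Fintype.card (Fin m → Equiv.Perm (Fin d)) : ℂ) * (d.factorial : ℂ) ≠ 0 := by
    refine mul_ne_zero ?_ ?_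
    · exact_mod_cast Fintype.card_ne_zero
    · exact_mod_cast d.factorial_ne_zero
  refine ⟨(((Fintype.card (Fin m → Equiv.Perm (Fin d)) : ℂ) * (d.factorial : ℂ)))⁻¹ •
    symToWedge (d := d) b f, ?_⟩
  rw [map_smul, h1, inv_smul_smul₀ h2]

end WedgeInverse

/-! ### Osculating spaces of Segre varieties -/

section Calculus

variable {E : Type*} [NormedAddCommGroup E] [NormedSpace ℂ E]

theorem iteratedFDeriv_mul_eq_zero {f g : E → ℂ} {x : E} (hf : AnalyticAt ℂ f x)
    (hg : AnalyticAt ℂ g x) (hf0 : f x = 0) {k : ℕ} (hgk : ∀ j < k, iteratedFDeriv ℂ j g x = 0)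
    {j : ℕ} (hj : j < k + 1) : iteratedFDeriv ℂ j (fun y => f y * g y) x = 0 := by
  set s : Set E := {y | AnalyticAt ℂ f y} ∩ {y | AnalyticAt ℂ g y}
  have hs : IsOpen s := (isOpen_analyticAt ℂ f).inter (isOpen_analyticAt ℂ g)
  have hx : x ∈ s := ⟨hf, hg⟩
  have hfs : ContDiffOn ℂ j f s := fun y hy => hy.1.contDiffAt.contDiffWithinAt
  have hgs : ContDiffOn ℂ j g s := fun y hy => hy.2.contDiffAt.contDiffWithinAt
  have h := norm_iteratedFDerivWithin_mul_le hfs hgs hs.uniqueDiffOn hx le_rfl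
  simp only [iteratedFDerivWithin_of_isOpen _ hs hx] at h
  rw [Finset.sum_eq_zero] at h
  · exact norm_le_zero_iff.mp h
  · intro i hi
    have := Finset.mem_range.mp hi
    rcases Nat.eq_zero_or_pos i with rfl | hi0
    · simp [hf0]
    · rw [hgk (j - i) (by omega)]
      simp

theorem iteratedFDeriv_mul_prod_eq_zero {ι : Type*} {A : Finset ι} {h : ι → E → ℂ} {u : E → ℂ}
    {x : E} (hu : AnalyticAt ℂ u x) (hh : ∀ i ∈ A, AnalyticAt ℂ (h i) x)
    (h0 : ∀ i ∈ A, h i x = 0) {j : ℕ} (hj : j < A.card) :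
    iteratedFDeriv ℂ j (fun y => u y * ∏ i ∈ A, h i y) x = 0 := by
  classical
  induction A using Finset.induction_on generalizing j with
  | empty => simp at hj
  | insert a A ha ih =>
    rw [Finset.card_insert_of_notMem ha] at hj
    have : (fun y => u y * ∏ i ∈ insert a A, h i y) =
        fun y => h a y * (u y * ∏ i ∈ A, h i y) := by
      funext y
      rw [Finset.prod_insert ha]
      ring
    rw [this]
    refine iteratedFDeriv_mul_eq_zero (hh a (Finset.mem_insert_self _ _)) (hu.mul ?_)
      (h0 a (Finset.mem_insert_self _ _))
      (fun j' hj' => ih (fun i hi => hh i (Finset.mem_insert_of_mem hi))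
        (fun i hi => h0 i (Finset.mem_insert_of_mem hi)) hj') hj
    exact Finset.analyticAt_fun_prod _ fun i hi => hh i (Finset.mem_insert_of_mem hi)

end Calculus

section Osculating

universe u

variable {m : ℕ} {V : Fin m → Type u} [∀ i, AddCommGroup (V i)] [∀ i, Module ℂ (V i)]

/-- The span of the decomposable functionals that differ from `ℓ` in at most `k` factors. -/
def osculatingTensors (k : ℕ) (ℓ : ∀ i, Module.Dual ℂ (V i)) :
    Submodule ℂ (Module.Dual ℂ (⨂[ℂ] i, V i)) :=
  Submodule.span ℂ {x | ∃ ℓ' : ∀ i, Module.Dual ℂ (V i), x = tensorFunctional V ℓ' ∧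
    ∃ A : Finset (Fin m), A.card ≤ k ∧ ∀ i ∉ A, ℓ' i = ℓ i}

theorem tensorFunctional_smul (c : Fin m → ℂ) (ℓ : ∀ i, Module.Dual ℂ (V i)) :
    tensorFunctional V (fun i => c i • ℓ i) = (∏ i, c i) • tensorFunctional V ℓ := by
  simp only [tensorFunctional, MultilinearMap.map_smul_univ, map_smul]

theorem exists_adapted_basis {F : Type*} [AddCommGroup F] [Module ℂ F] [FiniteDimensional ℂ F]
    (ℓ : Module.Dual ℂ F) (v : F) (h : ℓ v = 1) :
    ∃ (n : ℕ) (b : Module.Basis (Fin (n + 1)) ℂ F), b 0 = v ∧ b.coord 0 = ℓ := by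
  let c := Module.finBasis ℂ (LinearMap.ker ℓ)
  let b := Module.Basis.mkFinCons v c
    (by
      intro a x hx h0
      have h1 := congrArg ℓ h0
      rw [map_add, map_smul, h, LinearMap.mem_ker.mp hx] at h1
      simpa using h1)
    (by
      intro z
      exact ⟨-ℓ z, by simp [h]⟩)
  have hb0 : b 0 = v := by simp [b]
  refine ⟨_, b, hb0, b.ext fun a => ?_⟩
  refine Fin.cases ?_ (fun a => ?_) a
  · rw [hb0, h, ← hb0]
    simp
  · have h1 : b a.succ = c a := by simp [b]
    have h2 : ℓ (b a.succ) = 0 := by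
      rw [h1]
      exact LinearMap.mem_ker.mp (c a).2
    rw [h2, Module.Basis.coord_apply, b.repr_self, Finsupp.single_eq_of_ne (Fin.succ_ne_zero a).symm]

theorem exists_adapted_bases [∀ i, FiniteDimensional ℂ (V i)] (ℓ : ∀ i, Module.Dual ℂ (V i))
    (v : ∀ i, V i) (h : ∀ i, ℓ i (v i) = 1) :
    ∃ (n : Fin m → ℕ) (b : ∀ i, Module.Basis (Fin (n i + 1)) ℂ (V i)),
      (∀ i, b i 0 = v i) ∧ ∀ i, (b i).coord 0 = ℓ i := by
  choose n b hb using fun i => exists_adapted_basis (ℓ i) (v i) (h i)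
  exact ⟨n, b, fun i => (hb i).1, fun i => (hb i).2⟩

theorem mem_osculatingTensors {n : Fin m → ℕ} (b : ∀ i, Module.Basis (Fin (n i + 1)) ℂ (V i))
    (k : ℕ) (p : Module.Dual ℂ (⨂[ℂ] i, V i))
    (h : ∀ J : ∀ i, Fin (n i + 1), k < (Finset.univ.filter fun i => J i ≠ 0).card →
      p (PiTensorProduct.tprod ℂ fun i => b i (J i)) = 0) :
    p ∈ osculatingTensors k fun i => (b i).coord 0 := by
  have h1 : p = ∑ J : ∀ i, Fin (n i + 1), p (PiTensorProduct.tprod ℂ fun i => b i (J i)) •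
      tensorFunctional V fun i => (b i).coord (J i) := by
    refine LinearMap.ext fun w => ?_
    conv_lhs => rw [eq_sum_tensorFunctional_coord b w]
    simp [mul_comm]
  rw [h1]
  refine Submodule.sum_mem _ fun J _ => ?_
  by_cases hJ : k < (Finset.univ.filter fun i => J i ≠ 0).card
  · rw [h J hJ, zero_smul]
    exact Submodule.zero_mem _
  · refine Submodule.smul_mem _ _ (Submodule.subset_span ⟨_, rfl,
      Finset.univ.filter fun i => J i ≠ 0, not_lt.mp hJ, fun i hi => ?_⟩)
    have : J i = 0 := by simpa using hi
    rw [this]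

theorem exists_of_mem_affineCone {p : Module.Dual ℂ (⨂[ℂ] i, V i)}
    (hp : p ∈ affineCone (segreVariety V)) (h0 : p ≠ 0) :
    ∃ (c : ℂ) (ℓ : ∀ i, Module.Dual ℂ (V i)), p = c • tensorFunctional V ℓ := by
  obtain ⟨ℓ, hℓ, h⟩ := hp h0
  obtain ⟨c, hc⟩ := (Projectivization.mk_eq_mk_iff' ℂ _ _ h0 _).mp h
  exact ⟨c, ℓ, hc.symm⟩

theorem decomposable_apply (c : ℂ) (ℓ : ∀ i, Module.Dual ℂ (V i)) (v w : ∀ i, V i)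
    (h : (c • tensorFunctional V ℓ) (PiTensorProduct.tprod ℂ v) ≠ 0) (i : Fin m) :
    (c • tensorFunctional V ℓ) (PiTensorProduct.tprod ℂ (Function.update v i (w i))) /
      (c • tensorFunctional V ℓ) (PiTensorProduct.tprod ℂ v) = ℓ i (w i) / ℓ i (v i) := by
  simp only [LinearMap.smul_apply, tensorFunctional_tprod, smul_eq_mul] at h ⊢
  have hc := left_ne_zero_of_mul h
  have hv : ∀ j, ℓ j (v j) ≠ 0 := fun j =>
    Finset.prod_ne_zero_iff.mp (right_ne_zero_of_mul h) j (Finset.mem_univ _)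
  rw [mul_div_mul_left _ _ hc, ← Finset.prod_div_distrib, Finset.prod_eq_single i]
  · simp
  · intro j _ hj
    rw [Function.update_of_ne hj, div_self (hv j)]
  · simp

theorem decomposable_apply_eq {p : Module.Dual ℂ (⨂[ℂ] i, V i)}
    (hp : p ∈ affineCone (segreVariety V)) (v w : ∀ i, V i)
    (h : p (PiTensorProduct.tprod ℂ v) ≠ 0) :
    p (PiTensorProduct.tprod ℂ w) = p (PiTensorProduct.tprod ℂ v) *
      ∏ i, p (PiTensorProduct.tprod ℂ (Function.update v i (w i))) /
        p (PiTensorProduct.tprod ℂ v) := by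
  obtain ⟨c, ℓ, rfl⟩ := exists_of_mem_affineCone hp (by rintro rfl; simp at h)
  simp_rw [decomposable_apply c ℓ v w h]
  simp only [LinearMap.smul_apply, tensorFunctional_tprod, smul_eq_mul] at h ⊢
  have hv : ∀ j, ℓ j (v j) ≠ 0 := fun j =>
    Finset.prod_ne_zero_iff.mp (right_ne_zero_of_mul h) j (Finset.mem_univ _)
  rw [Finset.prod_div_distrib, mul_assoc, mul_div_cancel₀]
  exact right_ne_zero_of_mul h

theorem osculatingSpace_le [∀ i, FiniteDimensional ℂ (V i)] (k : ℕ)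
    (ℓ : ∀ i, Module.Dual ℂ (V i)) (hℓ : ∀ i, ℓ i ≠ 0) :
    osculatingSpace k (segreVariety V)
      (Projectivization.mk ℂ (tensorFunctional V ℓ) (tensorFunctional_ne_zero V ℓ hℓ)) ≤
      osculatingTensors k ℓ := by
  have h : ∀ i, ∃ v : V i, ℓ i v = 1 := by
    intro i
    have : ∃ v : V i, ℓ i v ≠ 0 := by
      by_contra! hc
      exact hℓ i (LinearMap.ext hc)
    obtain ⟨v, hv⟩ := this
    exact ⟨(ℓ i v)⁻¹ • v, by simp [hv]⟩
  choose v hv using h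
  obtain ⟨n, b, hb, hbℓ⟩ := exists_adapted_bases ℓ v hv
  refine Submodule.span_le.mpr ?_
  rintro p ⟨N, φ, hφ, j, w, hj, hp⟩
  have hbℓ' : ℓ = fun i => (b i).coord 0 := funext fun i => (hbℓ i).symm
  obtain ⟨h0, hbase⟩ := hφ.base
  obtain ⟨c, hc⟩ := (Projectivization.mk_eq_mk_iff' ℂ _ _ h0 _).mp hbase
  have hc0 : c ≠ 0 := by
    rintro rfl
    exact h0 (by rw [← hc, zero_smul])
  rw [hbℓ']
  refine mem_osculatingTensors b k p fun J hJ => ?_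
  rw [hp]
  set g : (Fin N → ℂ) → ℂ := fun t => φ t (PiTensorProduct.tprod ℂ v) with hg
  set f : Fin m → (Fin N → ℂ) → ℂ := fun i t =>
    φ t (PiTensorProduct.tprod ℂ (Function.update v i (b i (J i)))) / g t with hf
  have hg0 : g 0 ≠ 0 := by
    simp only [hg, ← hc, LinearMap.smul_apply, tensorFunctional_tprod, hv]
    simpa using hc0
  have hga : AnalyticAt ℂ g 0 := hφ.analytic _
  have hfa : ∀ i, AnalyticAt ℂ (f i) 0 := fun i => (hφ.analytic _).div hga hg0
  set A := Finset.univ.filter fun i => J i ≠ 0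
  have hev : (fun t => φ t (PiTensorProduct.tprod ℂ fun i => b i (J i))) =ᶠ[𝓝 0]
      fun t => (g t * ∏ i ∈ Aᶜ, f i t) * ∏ i ∈ A, f i t := by
    filter_upwards [hφ.mem_cone, hga.continuousAt.eventually_ne hg0] with t ht hgt
    rw [decomposable_apply_eq ht v _ hgt, mul_assoc, mul_comm (∏ i ∈ Aᶜ, f i t),
      Finset.prod_mul_prod_compl]
  rw [(hev.iteratedFDeriv ℂ j).self_of_nhds,
    iteratedFDeriv_mul_prod_eq_zero (u := fun t => g t * ∏ i ∈ Aᶜ, f i t)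
    (hga.mul (Finset.analyticAt_fun_prod _ fun i _ => hfa i)) (fun i _ => hfa i) ?_
    (lt_of_le_of_lt hj hJ)]
  · rfl
  · intro i hi
    have hJi : J i ≠ 0 := (Finset.mem_filter.mp hi).2
    simp only [hf, hg, ← hc]
    rw [decomposable_apply c ℓ v (fun i => b i (J i))]
    · rw [← hbℓ, Module.Basis.coord_apply, (b i).repr_self, Finsupp.single_eq_of_ne hJi.symm,
        zero_div]
    · rw [hc]
      exact hg0

end Osculating

section Chart

universe u

variable {m : ℕ} {V : Fin m → Type u} [∀ i, AddCommGroup (V i)] [∀ i, Module ℂ (V i)]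
  {n : Fin m → ℕ} (b : ∀ i, Module.Basis (Fin (n i + 1)) ℂ (V i))

/-- The functional on the `i`-th factor with affine coordinates `t`. -/
def chartCovector (t : Fin (∑ i, n i) → ℂ) (i : Fin m) : Module.Dual ℂ (V i) :=
  (b i).coord 0 + ∑ a : Fin (n i), t (finSigmaFinEquiv ⟨i, a⟩) • (b i).coord a.succ

/-- The affine chart of the Segre variety attached to bases of the factors. -/
def segreChart (t : Fin (∑ i, n i) → ℂ) : Module.Dual ℂ (⨂[ℂ] i, V i) :=
  tensorFunctional V (chartCovector b t)

theorem chartCovector_zero (t : Fin (∑ i, n i) → ℂ) (i : Fin m) :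
    chartCovector b t i (b i 0) = 1 := by
  simp [chartCovector]

theorem chartCovector_succ (t : Fin (∑ i, n i) → ℂ) (i : Fin m) (a : Fin (n i)) :
    chartCovector b t i (b i a.succ) = t (finSigmaFinEquiv ⟨i, a⟩) := by
  simp [chartCovector, Finsupp.single_apply, Fin.succ_ne_zero]

theorem chartCovector_ne_zero (t : Fin (∑ i, n i) → ℂ) (i : Fin m) : chartCovector b t i ≠ 0 := by
  intro h
  simpa [h] using chartCovector_zero b t i

theorem eq_smul_chartCovector (t : Fin (∑ i, n i) → ℂ) (i : Fin m) (μ : Module.Dual ℂ (V i))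
    (h0 : μ (b i 0) ≠ 0)
    (h : ∀ a : Fin (n i), t (finSigmaFinEquiv ⟨i, a⟩) = μ (b i a.succ) / μ (b i 0)) :
    μ = μ (b i 0) • chartCovector b t i := by
  refine (b i).ext fun a => ?_
  refine Fin.cases ?_ (fun a => ?_) a
  · rw [LinearMap.smul_apply, chartCovector_zero, smul_eq_mul, mul_one]
  · rw [LinearMap.smul_apply, chartCovector_succ, h, smul_eq_mul, mul_div_cancel₀ _ h0]

theorem chartCovector_at_zero : chartCovector b 0 = fun i => (b i).coord 0 := by
  funext i
  simp [chartCovector]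

/-- The tensor which detects the `j`-th affine coordinate. -/
def chartTest (j : Fin (∑ i, n i)) : ⨂[ℂ] i, V i :=
  PiTensorProduct.tprod ℂ (Function.update (fun i => b i 0) (finSigmaFinEquiv.symm j).1
    (b _ (finSigmaFinEquiv.symm j).2.succ))

theorem chartTest_apply (i : Fin m) (a : Fin (n i)) : chartTest b (finSigmaFinEquiv ⟨i, a⟩) =
    PiTensorProduct.tprod ℂ (Function.update (fun i => b i 0) i (b i a.succ)) := by
  unfold chartTest
  generalize hs : finSigmaFinEquiv.symm (finSigmaFinEquiv (⟨i, a⟩ : (i : Fin m) × Fin (n i))) = s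
  rw [Equiv.symm_apply_apply] at hs
  subst hs
  rfl

theorem segreChart_base (t : Fin (∑ i, n i) → ℂ) :
    segreChart b t (PiTensorProduct.tprod ℂ fun i => b i 0) = 1 := by
  simp [segreChart, tensorFunctional_tprod, chartCovector_zero]

theorem segreChart_test (t : Fin (∑ i, n i) → ℂ) (j : Fin (∑ i, n i)) :
    segreChart b t (chartTest b j) = t j := by
  rw [segreChart, chartTest, tensorFunctional_tprod,
    Finset.prod_eq_single (finSigmaFinEquiv.symm j).1]
  · rw [Function.update_self, chartCovector_succ, Sigma.eta, Equiv.apply_symm_apply]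
  · intro i _ hi
    rw [Function.update_of_ne hi, chartCovector_zero]
  · simp

theorem segreChart_analyticAt (w : ⨂[ℂ] i, V i) (x : Fin (∑ i, n i) → ℂ) :
    AnalyticAt ℂ (fun t => segreChart b t w) x := by
  induction w using PiTensorProduct.induction_on with
  | smul_tprod r u =>
    simp only [map_smul, segreChart, tensorFunctional_tprod, smul_eq_mul]
    refine analyticAt_const.mul (Finset.analyticAt_fun_prod _ fun i _ => ?_)
    simp only [chartCovector, LinearMap.add_apply, LinearMap.sum_apply, LinearMap.smul_apply,
      smul_eq_mul]
    refine analyticAt_const.add (Finset.analyticAt_fun_sum _ fun a _ => AnalyticAt.mul ?_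
      analyticAt_const)
    exact (ContinuousLinearMap.proj (R := ℂ) (φ := fun _ : Fin (∑ i, n i) => ℂ)
      (finSigmaFinEquiv ⟨i, a⟩)).analyticAt x
  | add w w' h h' =>
    simp only [map_add]
    exact h.add h'

theorem segreChart_zero_ne (h : ∀ i, (b i).coord 0 ≠ 0) :
    segreChart b 0 ≠ 0 := by
  rw [segreChart, chartCovector_at_zero]
  exact tensorFunctional_ne_zero V _ h

theorem tendsto_dualNhds {W : Type u} [AddCommGroup W] [Module ℂ W] (p : Module.Dual ℂ W) (w : W) :
    Filter.Tendsto (fun x : Module.Dual ℂ W => x w) (dualNhds p) (𝓝 (p w)) :=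
  ((continuous_apply w).tendsto (p : W → ℂ)).comp Filter.tendsto_comap

theorem isLocalParam_segreChart (h : ∀ i, (b i).coord 0 ≠ 0) :
    IsLocalParam (segreVariety V) (Projectivization.mk ℂ
      (tensorFunctional V fun i => (b i).coord 0) (tensorFunctional_ne_zero V _ h))
      (segreChart b) where
  analytic w := segreChart_analyticAt b w 0
  base := by
    refine ⟨segreChart_zero_ne b h, ?_⟩
    congr 1
    rw [segreChart, chartCovector_at_zero]
  mem_cone := Filter.Eventually.of_forall fun t _ =>
    ⟨chartCovector b t, chartCovector_ne_zero b t, rfl⟩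
  immersion := by
    rw [Fintype.linearIndependent_iff]
    intro g hg
    have h1 : ∀ w, g 0 * segreChart b 0 w + ∑ j, g j.succ *
        fderiv ℂ (fun t => segreChart b t w) 0 (Pi.single j 1) = 0 := by
      intro w
      have := congrFun hg w
      rw [Fin.sum_univ_succ] at this
      simpa using this
    have h2 := h1 (PiTensorProduct.tprod ℂ fun i => b i 0)
    simp only [segreChart_base] at h2
    have h3 : g 0 = 0 := by simpa using h2
    have h4 : ∀ j, g (Fin.succ j) = 0 := by
      intro j
      have h5 := h1 (chartTest b j)
      simp only [segreChart_test] at h5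
      have h6 : fderiv ℂ (fun t : Fin (∑ i, n i) → ℂ => t j) 0 =
          ContinuousLinearMap.proj (R := ℂ) (φ := fun _ : Fin (∑ i, n i) => ℂ) j :=
        (ContinuousLinearMap.proj (R := ℂ) (φ := fun _ : Fin (∑ i, n i) => ℂ) j).fderiv
      rw [h6, h3] at h5
      simpa [Pi.single_apply] using h5
    exact fun i => Fin.cases h3 h4 i
  onto := by
    intro N hN
    let T : Module.Dual ℂ (⨂[ℂ] i, V i) → Fin (∑ i, n i) → ℂ := fun p j =>
      p (chartTest b j) / p (PiTensorProduct.tprod ℂ fun i => b i 0)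
    have hT : Filter.Tendsto T (dualNhds (segreChart b 0)) (𝓝 0) := by
      refine tendsto_pi_nhds.mpr fun j => ?_
      have := (tendsto_dualNhds (segreChart b 0) (chartTest b j)).div
        (tendsto_dualNhds (segreChart b 0) (PiTensorProduct.tprod ℂ fun i => b i 0))
        (by rw [segreChart_base]; exact one_ne_zero)
      rwa [segreChart_test, segreChart_base, div_one] at this
    have hne : ∀ᶠ p in dualNhds (segreChart b 0),
        p (PiTensorProduct.tprod ℂ fun i => b i 0) ≠ 0 :=
      (tendsto_dualNhds (segreChart b 0) _).eventually_ne
        (by rw [segreChart_base]; exact one_ne_zero)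
    filter_upwards [hT hN, hne] with p hp hp0 hcone
    refine ⟨T p, hp, ?_⟩
    obtain ⟨c, μ, rfl⟩ := exists_of_mem_affineCone hcone (by rintro rfl; simp at hp0)
    have hμ : ∀ i, μ i (b i 0) ≠ 0 := by
      intro i
      simp only [LinearMap.smul_apply, tensorFunctional_tprod, smul_eq_mul] at hp0
      exact Finset.prod_ne_zero_iff.mp (right_ne_zero_of_mul hp0) i (Finset.mem_univ _)
    have h1 : μ = fun i => μ i (b i 0) • chartCovector b (T (c • tensorFunctional V μ)) i := by
      funext i
      refine eq_smul_chartCovector b _ i _ (hμ i) fun a => ?_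
      simp only [T, chartTest_apply]
      have := decomposable_apply c μ (fun i => b i 0)
        (Function.update (fun i => b i 0) i (b i a.succ)) hp0 i
      simpa using this
    refine ⟨c * ∏ i, μ i (b i 0), ?_⟩
    conv_lhs => rw [h1, tensorFunctional_smul, smul_smul]
    rfl

theorem segreVariety_subset_smoothLocus [∀ i, FiniteDimensional ℂ (V i)] :
    segreVariety V ⊆ smoothLocus (segreVariety V) := by
  rintro z ⟨ℓ, hℓ, rfl⟩
  refine ⟨⟨ℓ, hℓ, rfl⟩, ?_⟩
  have h : ∀ i, ∃ v : V i, ℓ i v = 1 := by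
    intro i
    have : ∃ v : V i, ℓ i v ≠ 0 := by
      by_contra! hc
      exact hℓ i (LinearMap.ext hc)
    obtain ⟨v, hv⟩ := this
    exact ⟨(ℓ i v)⁻¹ • v, by simp [hv]⟩
  choose v hv using h
  obtain ⟨n, b, hb, hbℓ⟩ := exists_adapted_bases ℓ v hv
  obtain rfl : ℓ = fun i => (b i).coord 0 := funext fun i => (hbℓ i).symm
  exact ⟨_, _, isLocalParam_segreChart b hℓ⟩

end Chart

section Taylor

theorem iteratedDeriv_polynomial (P : Polynomial ℂ) (j : ℕ) :
    iteratedDeriv j (fun s => P.eval s) 0 = j.factorial * P.coeff j := by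
  have h : ∀ (j : ℕ) (P : Polynomial ℂ), iteratedDeriv j (fun s => P.eval s) =
      fun s => (Polynomial.derivative^[j] P).eval s := by
    intro j
    induction j with
    | zero => intro P; simp
    | succ j ih =>
      intro P
      have hd : deriv (fun s => P.eval s) = fun s => P.derivative.eval s := by
        funext s
        exact P.deriv
      rw [iteratedDeriv_succ', hd, ih, Function.iterate_succ_apply]
  rw [h]
  beta_reduce
  rw [← Polynomial.coeff_zero_eq_eval_zero, Polynomial.coeff_iterate_derivative]
  simp [Nat.descFactorial_self]

theorem eq_sum_iteratedFDeriv {E : Type*} [NormedAddCommGroup E] [NormedSpace ℂ E] {g : E → ℂ}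
    (hg : ∀ x, AnalyticAt ℂ g x) {k : ℕ} (y : E) (P : Polynomial ℂ) (hP : P.natDegree ≤ k)
    (h : ∀ s : ℂ, g (s • y) = P.eval s) :
    g y = ∑ j ∈ Finset.range (k + 1), ((j.factorial : ℂ))⁻¹ *
      iteratedFDeriv ℂ j g 0 fun _ => y := by
  have h1 := h 1
  rw [one_smul] at h1
  rw [h1, Polynomial.eval_eq_sum_range' (Nat.lt_succ_of_le hP)]
  refine Finset.sum_congr rfl fun j _ => ?_
  have h2 := iteratedDeriv_polynomial P j
  have h3 : (fun s => P.eval s) = g ∘ (ContinuousLinearMap.toSpanSingleton ℂ y) := by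
    funext s
    simp [h]
  have hc : ContDiff ℂ j g := contDiff_iff_contDiffAt.mpr fun x => (hg x).contDiffAt
  rw [h3, iteratedDeriv_eq_iteratedFDeriv,
    ContinuousLinearMap.iteratedFDeriv_comp_right _ hc _ le_rfl] at h2
  simp only [ContinuousMultilinearMap.compContinuousLinearMap_apply,
    ContinuousLinearMap.toSpanSingleton_apply, one_smul, zero_smul] at h2
  rw [h2, one_pow, mul_one, inv_mul_cancel_left₀]
  exact_mod_cast j.factorial_ne_zero

end Taylor

section OsculatingEquality

universe u

variable {m : ℕ} {V : Fin m → Type u} [∀ i, AddCommGroup (V i)] [∀ i, Module ℂ (V i)]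

theorem exists_polynomial_segreChart {n : Fin m → ℕ}
    (b : ∀ i, Module.Basis (Fin (n i + 1)) ℂ (V i)) (τ : Fin (∑ i, n i) → ℂ) (A : Finset (Fin m))
    (hA : ∀ i ∉ A, ∀ a : Fin (n i), τ (finSigmaFinEquiv ⟨i, a⟩) = 0) (w : ⨂[ℂ] i, V i) :
    ∃ P : Polynomial ℂ, P.natDegree ≤ A.card ∧ ∀ s : ℂ, segreChart b (s • τ) w = P.eval s := by
  classical
  induction w using PiTensorProduct.induction_on with
  | smul_tprod r u =>
    let β : Fin m → ℂ := fun i => ∑ a, τ (finSigmaFinEquiv ⟨i, a⟩) * (b i).coord a.succ (u i)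
    have hβ : ∀ i ∉ A, β i = 0 := fun i hi => Finset.sum_eq_zero fun a _ => by
      rw [hA i hi, zero_mul]
    refine ⟨Polynomial.C r * ∏ i, (Polynomial.C ((b i).coord 0 (u i)) +
      Polynomial.C (β i) * Polynomial.X), ?_, fun s => ?_⟩
    · refine (Polynomial.natDegree_C_mul_le _ _).trans ((Polynomial.natDegree_prod_le _ _).trans ?_)
      refine (Finset.sum_le_sum (g := fun i => if i ∈ A then 1 else 0) fun i _ => ?_).trans
        (by simp)
      split_ifs with hi
      · compute_degree
      · rw [hβ i hi]
        simp
    · simp only [map_smul, segreChart, tensorFunctional_tprod, smul_eq_mul, Polynomial.eval_mul,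
        Polynomial.eval_C, Polynomial.eval_prod, Polynomial.eval_add, Polynomial.eval_X]
      congr 1
      refine Finset.prod_congr rfl fun i _ => ?_
      simp only [chartCovector, LinearMap.add_apply, LinearMap.sum_apply, LinearMap.smul_apply,
        smul_eq_mul, Pi.smul_apply, β, Finset.sum_mul]
      congr 1
      exact Finset.sum_congr rfl fun a _ => by ring
  | add w w' h h' =>
    obtain ⟨P, hP, hP'⟩ := h
    obtain ⟨Q, hQ, hQ'⟩ := h'
    refine ⟨P + Q, (Polynomial.natDegree_add_le _ _).trans (max_le hP hQ), fun s => ?_⟩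
    rw [map_add, hP', hQ', Polynomial.eval_add]

theorem segreChart_mem_osculatingSpace {n : Fin m → ℕ}
    (b : ∀ i, Module.Basis (Fin (n i + 1)) ℂ (V i)) (h : ∀ i, (b i).coord 0 ≠ 0)
    (τ : Fin (∑ i, n i) → ℂ) (A : Finset (Fin m)) {k : ℕ} (hAk : A.card ≤ k)
    (hA : ∀ i ∉ A, ∀ a : Fin (n i), τ (finSigmaFinEquiv ⟨i, a⟩) = 0) :
    segreChart b τ ∈ osculatingSpace k (segreVariety V) (Projectivization.mk ℂ
      (tensorFunctional V fun i => (b i).coord 0) (tensorFunctional_ne_zero V _ h)) := by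
  have hc : ∀ (j : ℕ) w, ContDiffAt ℂ j (fun t => segreChart b t w) 0 :=
    fun j w => (segreChart_analyticAt b w 0).contDiffAt
  let D : ∀ j : ℕ, (Fin j → Fin (∑ i, n i)) → Module.Dual ℂ (⨂[ℂ] i, V i) := fun j ω =>
    { toFun := fun w =>
        iteratedFDeriv ℂ j (fun t => segreChart b t w) 0 fun a => Pi.single (ω a) 1
      map_add' := fun w w' => by
        simp only [map_add]
        rw [fun_iteratedFDeriv_add_apply (hc j w) (hc j w')]
        rfl
      map_smul' := fun c w => by
        simp only [map_smul]
        rw [iteratedFDeriv_const_smul_apply' (hc j w)]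
        rfl }
  have hD : segreChart b τ = ∑ j ∈ Finset.range (k + 1), ((j.factorial : ℂ))⁻¹ •
      ∑ ω : Fin j → Fin (∑ i, n i), (∏ a, τ (ω a)) • D j ω := by
    refine LinearMap.ext fun w => ?_
    obtain ⟨P, hP, hP'⟩ := exists_polynomial_segreChart b τ A hA w
    rw [eq_sum_iteratedFDeriv (segreChart_analyticAt b w) τ P (hP.trans hAk) hP',
      LinearMap.sum_apply]
    refine Finset.sum_congr rfl fun j _ => ?_
    rw [LinearMap.smul_apply, LinearMap.sum_apply, smul_eq_mul]
    congr 1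
    have hτ : (fun _ : Fin j => τ) =
        fun _ => ∑ r, τ r • (Pi.single r (1 : ℂ) : Fin (∑ i, n i) → ℂ) := by
      funext _
      exact pi_eq_sum_univ' τ
    rw [hτ, ContinuousMultilinearMap.map_sum]
    refine Finset.sum_congr rfl fun ω _ => ?_
    exact ContinuousMultilinearMap.map_smul_univ _ _ _
  rw [hD]
  refine Submodule.sum_mem _ fun j hj => Submodule.smul_mem _ _ (Submodule.sum_mem _ fun ω _ =>
    Submodule.smul_mem _ _ (Submodule.subset_span ?_))
  exact ⟨_, segreChart b, isLocalParam_segreChart b h, j, ω,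
    Nat.lt_succ_iff.mp (Finset.mem_range.mp hj), fun w => rfl⟩

theorem exists_common_nonzero {F : Type*} [AddCommGroup F] [Module ℂ F] {ℓ ℓ' : Module.Dual ℂ F}
    (h : ℓ ≠ 0) (h' : ℓ' ≠ 0) : ∃ v, ℓ v = 1 ∧ ℓ' v ≠ 0 := by
  have h1 : ∃ v, ℓ v ≠ 0 := by
    by_contra! hc
    exact h (LinearMap.ext hc)
  have h2 : ∃ v, ℓ' v ≠ 0 := by
    by_contra! hc
    exact h' (LinearMap.ext hc)
  obtain ⟨v, hv⟩ := h1
  obtain ⟨v', hv'⟩ := h2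
  have h3 : ∃ u, ℓ u ≠ 0 ∧ ℓ' u ≠ 0 := by
    by_cases h4 : ℓ' v = 0
    · by_cases h5 : ℓ v' = 0
      · exact ⟨v + v', by simpa [h5] using hv, by simpa [h4] using hv'⟩
      · exact ⟨v', h5, hv'⟩
    · exact ⟨v, hv, h4⟩
  obtain ⟨u, hu, hu'⟩ := h3
  exact ⟨(ℓ u)⁻¹ • u, by simp [hu], by simp [hu, hu']⟩

theorem osculatingSpace_segreVariety [∀ i, FiniteDimensional ℂ (V i)] (k : ℕ)
    (ℓ : ∀ i, Module.Dual ℂ (V i)) (hℓ : ∀ i, ℓ i ≠ 0) :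
    osculatingSpace k (segreVariety V)
      (Projectivization.mk ℂ (tensorFunctional V ℓ) (tensorFunctional_ne_zero V ℓ hℓ)) =
      osculatingTensors k ℓ := by
  refine le_antisymm (osculatingSpace_le k ℓ hℓ) (Submodule.span_le.mpr ?_)
  rintro x ⟨ℓ', rfl, A, hAk, hA⟩
  by_cases h0 : ∃ i, ℓ' i = 0
  · obtain ⟨i, hi⟩ := h0
    have : tensorFunctional V ℓ' = 0 := by
      rw [tensorFunctional, MultilinearMap.map_coord_zero _ i hi, map_zero]
    rw [this]
    exact Submodule.zero_mem _
  push Not at h0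
  choose v hv hv' using fun i => exists_common_nonzero (hℓ i) (h0 i)
  obtain ⟨n, b, hb, hbℓ⟩ := exists_adapted_bases ℓ v hv
  obtain rfl : ℓ = fun i => (b i).coord 0 := funext fun i => (hbℓ i).symm
  obtain rfl : v = fun i => b i 0 := funext fun i => (hb i).symm
  let τ : Fin (∑ i, n i) → ℂ := fun j => ℓ' (finSigmaFinEquiv.symm j).1
    (b _ (finSigmaFinEquiv.symm j).2.succ) / ℓ' (finSigmaFinEquiv.symm j).1 (b _ 0)
  have hτ : ∀ i (a : Fin (n i)), τ (finSigmaFinEquiv ⟨i, a⟩) =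
      ℓ' i (b i a.succ) / ℓ' i (b i 0) := by
    intro i a
    simp only [τ]
    generalize hs : finSigmaFinEquiv.symm (finSigmaFinEquiv (⟨i, a⟩ : (i : Fin m) × Fin (n i))) = s
    rw [Equiv.symm_apply_apply] at hs
    subst hs
    rfl
  have h1 : ℓ' = fun i => ℓ' i (b i 0) • chartCovector b τ i := by
    funext i
    exact eq_smul_chartCovector b τ i _ (hv' i) (hτ i)
  rw [h1, tensorFunctional_smul]
  refine Submodule.smul_mem _ _ (segreChart_mem_osculatingSpace b hℓ τ A hAk fun i hi a => ?_)
  rw [hτ, hA i hi]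
  simp [Fin.succ_ne_zero]

end OsculatingEquality

/-! ### Vanishing along arbitrary tuples of osculating spaces -/

section Degeneration

universe u

variable {m : ℕ} {V : Fin m → Type u} [∀ i, AddCommGroup (V i)] [∀ i, Module ℂ (V i)]

theorem exists_sum_of_mem_iSup_osculatingTensors {q k : ℕ}
    {ℓ : Fin q → ∀ i, Module.Dual ℂ (V i)} {p : Module.Dual ℂ (⨂[ℂ] i, V i)}
    (hp : p ∈ ⨆ a, osculatingTensors k (ℓ a)) :
    ∃ (N : ℕ) (c : Fin N → ℂ) (a : Fin N → Fin q) (μ : Fin N → ∀ i, Module.Dual ℂ (V i))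
      (A : Fin N → Finset (Fin m)), (∀ r, (A r).card ≤ k) ∧
      (∀ r, ∀ i ∉ A r, μ r i = ℓ (a r) i) ∧ p = ∑ r, c r • tensorFunctional V (μ r) := by
  simp only [osculatingTensors] at hp
  rw [Submodule.iSup_span, Submodule.mem_span_set'] at hp
  obtain ⟨N, c, g, rfl⟩ := hp
  have hg : ∀ r, ∃ (a : Fin q) (μ : ∀ i, Module.Dual ℂ (V i)) (A : Finset (Fin m)),
      (g r : Module.Dual ℂ (⨂[ℂ] i, V i)) = tensorFunctional V μ ∧ A.card ≤ k ∧
        ∀ i ∉ A, μ i = ℓ a i := by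
    intro r
    obtain ⟨a, ha⟩ := Set.mem_iUnion.mp (g r).2
    obtain ⟨μ, hμ, A, hA, hA'⟩ := ha
    exact ⟨a, μ, A, hμ, hA, hA'⟩
  choose a μ A hg using hg
  refine ⟨N, c, a, μ, A, fun r => (hg r).2.1, fun r => (hg r).2.2, ?_⟩
  exact Finset.sum_congr rfl fun r _ => by rw [(hg r).1]

theorem tensorFunctional_mem_iSup {q k : ℕ} {ℓ : Fin q → ∀ i, Module.Dual ℂ (V i)} (a : Fin q)
    (μ : ∀ i, Module.Dual ℂ (V i)) (A : Finset (Fin m)) (hA : A.card ≤ k)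
    (h : ∀ i ∉ A, μ i = ℓ a i) :
    tensorFunctional V μ ∈ ⨆ a, osculatingTensors k (ℓ a) :=
  Submodule.mem_iSup_of_mem a (Submodule.subset_span ⟨μ, rfl, A, hA, h⟩)

theorem exists_biorthogonal {W : Type u} [AddCommGroup W] [Module ℂ W] [FiniteDimensional ℂ W]
    {r : Type*} [DecidableEq r] {x : r → Module.Dual ℂ W} (hx : LinearIndependent ℂ x) :
    ∃ w : r → W, ∀ a b, x a (w b) = if a = b then 1 else 0 := by
  obtain ⟨g, hg⟩ := (Finsupp.linearCombination ℂ x).exists_leftInverse_of_injective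
    (LinearMap.ker_eq_bot.mpr hx)
  refine ⟨fun b => (Module.evalEquiv ℂ W).symm (Finsupp.lapply b ∘ₗ g), fun a b => ?_⟩
  rw [Module.apply_evalEquiv_symm_apply]
  have h1 := LinearMap.congr_fun hg (Finsupp.single a 1)
  simp only [LinearMap.comp_apply, Finsupp.linearCombination_single, one_smul,
    LinearMap.id_apply] at h1
  simp [h1, Finsupp.single_apply]

theorem differentiable_tensorFunctional {μ : ℂ → ∀ i, Module.Dual ℂ (V i)}
    (h : ∀ i u, Differentiable ℂ fun s => μ s i u) (w : ⨂[ℂ] i, V i) :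
    Differentiable ℂ fun s => tensorFunctional V (μ s) w := by
  induction w using PiTensorProduct.induction_on with
  | smul_tprod r u =>
    simp only [map_smul, tensorFunctional_tprod, smul_eq_mul]
    exact (differentiable_const _).mul (Differentiable.fun_finsetProd fun i _ => h i _)
  | add w w' h h' =>
    simp only [map_add]
    exact h.add h'

theorem differentiable_evalAt {W : Type u} [AddCommGroup W] [Module ℂ W]
    {p : ℂ → Module.Dual ℂ W} (h : ∀ w, Differentiable ℂ fun s => p s w)
    (f : SymmetricAlgebra ℂ W) : Differentiable ℂ fun s => evalAt (p s) f := by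
  induction f using SymmetricAlgebra.induction with
  | algebraMap r => simp
  | ι w => simpa [evalAt] using h w
  | mul f g hf hg =>
    simp only [map_mul]
    exact hf.mul hg
  | add f g hf hg =>
    simp only [map_add]
    exact hf.add hg

theorem eq_zero_of_mul_eq_zero_of_differentiable {f g : ℂ → ℂ} (hf : Differentiable ℂ f)
    (hg : Differentiable ℂ g) (h : ∀ s, f s * g s = 0) (h0 : f 0 ≠ 0) (s : ℂ) : g s = 0 := by
  have ha : ∀ {f : ℂ → ℂ}, Differentiable ℂ f → AnalyticOnNhd ℂ f Set.univ := fun hf =>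
    hf.differentiableOn.analyticOnNhd isOpen_univ
  rcases (ha hf).eq_zero_or_eq_zero_of_mul_eq_zero (ha hg) (fun s _ => h s)
    isPreconnected_univ with h1 | h1
  · exact absurd (h1 0 (Set.mem_univ _)) h0
  · exact h1 s (Set.mem_univ _)

variable [∀ i, FiniteDimensional ℂ (V i)]

theorem exists_isGeneralTuple (q k : ℕ) (hne : ∀ i, ∃ ℓ : Module.Dual ℂ (V i), ℓ ≠ 0) :
    ∃ z : Fin q → ℙ ℂ (Module.Dual ℂ (⨂[ℂ] i, V i)), IsGeneralTuple k (segreVariety V) z := by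
  choose ℓ hℓ using hne
  have hS := segreVariety_subset_smoothLocus (V := V) ⟨ℓ, hℓ, rfl⟩
  let D : Set ℕ := {d | ∃ z : Fin q → ℙ ℂ (Module.Dual ℂ (⨂[ℂ] i, V i)),
    (∀ a, z a ∈ smoothLocus (segreVariety V)) ∧
      Module.finrank ℂ (osculatingSpan k (segreVariety V) z) = d}
  have hD : D.Nonempty := ⟨_, fun _ => _, fun _ => hS, rfl⟩
  have hb : BddAbove D := ⟨Module.finrank ℂ (Module.Dual ℂ (⨂[ℂ] i, V i)), by
    rintro d ⟨z, -, rfl⟩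
    exact Submodule.finrank_le _⟩
  obtain ⟨z, hz, hzd⟩ := Nat.sSup_mem hD hb
  exact ⟨z, hz, fun z' hz' => by
    rw [hzd]
    exact le_csSup hb ⟨z', hz', rfl⟩⟩

theorem osculatingSpan_segreVariety {q : ℕ} (k : ℕ) (ℓ : Fin q → ∀ i, Module.Dual ℂ (V i))
    (hℓ : ∀ a i, ℓ a i ≠ 0) :
    osculatingSpan k (segreVariety V) (fun a => Projectivization.mk ℂ
      (tensorFunctional V (ℓ a)) (tensorFunctional_ne_zero V (ℓ a) (hℓ a))) =
      ⨆ a, osculatingTensors k (ℓ a) :=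
  iSup_congr fun a => osculatingSpace_segreVariety k (ℓ a) (hℓ a)

theorem evalAt_eq_zero_of_isGeneralTuple {W : Type u} [AddCommGroup W] [Module ℂ W] {q k : ℕ}
    {X : Set (ℙ ℂ (Module.Dual ℂ W))} {f : SymmetricAlgebra ℂ W}
    (hf : f ∈ idealOf (secantOsculating q k X)) (h0 : evalAt 0 f = 0)
    {z : Fin q → ℙ ℂ (Module.Dual ℂ W)} (hz : IsGeneralTuple k X z) {p : Module.Dual ℂ W}
    (hp : p ∈ osculatingSpan k X z) : evalAt p f = 0 := by
  by_cases hp0 : p = 0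
  · rw [hp0, h0]
  · refine hf p hp0 fun g hg p' hp' h => hg p' hp' ?_
    refine ⟨z, hz, ?_⟩
    rw [h, Projectivization.submodule_mk]
    exact (Submodule.span_singleton_le_iff_mem _ _).mpr hp

/-- A form that vanishes on the secant variety to the osculating variety vanishes on the spans of
the osculating spaces at arbitrary points, even at those with non-maximal span. -/
theorem evalAt_eq_zero_of_mem_iSup {q k : ℕ} (hne : ∀ i, ∃ ℓ : Module.Dual ℂ (V i), ℓ ≠ 0)
    {f : SymmetricAlgebra ℂ (⨂[ℂ] i, V i)}
    (hf : f ∈ idealOf (secantOsculating q k (segreVariety V))) (hf0 : evalAt 0 f = 0)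
    (ℓ : Fin q → ∀ i, Module.Dual ℂ (V i)) (p : Module.Dual ℂ (⨂[ℂ] i, V i))
    (hp : p ∈ ⨆ a, osculatingTensors k (ℓ a)) : evalAt p f = 0 := by
  classical
  obtain ⟨z, hz⟩ := exists_isGeneralTuple (V := V) q k hne
  choose ℓ₀ hℓ₀ hzℓ₀ using fun a => (hz.1 a).1
  obtain rfl : z = fun a => Projectivization.mk ℂ (tensorFunctional V (ℓ₀ a))
    (tensorFunctional_ne_zero V (ℓ₀ a) (hℓ₀ a)) := funext hzℓ₀
  have hspan := osculatingSpan_segreVariety k ℓ₀ hℓ₀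
  obtain ⟨B, hBsub, hBspan, hBli⟩ := exists_linearIndependent ℂ
    (⋃ a, {x | ∃ ℓ' : ∀ i, Module.Dual ℂ (V i), x = tensorFunctional V ℓ' ∧
      ∃ A : Finset (Fin m), A.card ≤ k ∧ ∀ i ∉ A, ℓ' i = ℓ₀ a i})
  rw [← Submodule.iSup_span] at hBspan
  have : Fintype B := (LinearIndependent.setFinite hBli).fintype
  have hBgen : ∀ x : B, ∃ (a : Fin q) (μ : ∀ i, Module.Dual ℂ (V i)) (A : Finset (Fin m)),
      (x : Module.Dual ℂ (⨂[ℂ] i, V i)) = tensorFunctional V μ ∧ A.card ≤ k ∧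
        ∀ i ∉ A, μ i = ℓ₀ a i := by
    intro x
    obtain ⟨a, ha⟩ := Set.mem_iUnion.mp (hBsub x.2)
    obtain ⟨μ, hμ, A, hA, hA'⟩ := ha
    exact ⟨a, μ, A, hμ, hA, hA'⟩
  choose aB μB AB hB hAB hABμ using hBgen
  obtain ⟨w, hw⟩ := exists_biorthogonal hBli
  obtain ⟨N, c, a, μ, A, hA, hAμ, rfl⟩ := exists_sum_of_mem_iSup_osculatingTensors hp
  let L : ℂ → Fin q → ∀ i, Module.Dual ℂ (V i) := fun s a i => (1 - s) • ℓ₀ a i + s • ℓ a i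
  have hL : ∀ a i u, Differentiable ℂ fun s => L s a i u := by
    intro a i u
    simp only [L, LinearMap.add_apply, LinearMap.smul_apply, smul_eq_mul]
    fun_prop
  have hL0 : L 0 = ℓ₀ := by simp [L]
  have hL1 : L 1 = ℓ := by simp [L]
  let x : ℂ → B → Module.Dual ℂ (⨂[ℂ] i, V i) := fun s y =>
    tensorFunctional V fun i => if i ∈ AB y then μB y i else L s (aB y) i
  have hx : ∀ y u, Differentiable ℂ fun s => x s y u := by
    intro y
    refine differentiable_tensorFunctional fun i u => ?_
    split_ifs
    · exact differentiable_const _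
    · exact hL _ _ _
  have hx0 : ∀ y, x 0 y = y := by
    intro y
    rw [hB]
    simp only [x, hL0]
    congr 1
    funext i
    split_ifs with hi
    · rfl
    · rw [hABμ y i hi]
  let P : ℂ → Module.Dual ℂ (⨂[ℂ] i, V i) := fun s =>
    ∑ r, c r • tensorFunctional V fun i => if i ∈ A r then μ r i else L s (a r) i
  have hP : ∀ u, Differentiable ℂ fun s => P s u := by
    intro u
    simp only [P, LinearMap.sum_apply, LinearMap.smul_apply, smul_eq_mul]
    refine Differentiable.fun_sum fun r _ => (differentiable_const _).mul ?_
    refine differentiable_tensorFunctional (fun i u => ?_) u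
    split_ifs
    · exact differentiable_const _
    · exact hL _ _ _
  have hP1 : P 1 = ∑ r, c r • tensorFunctional V (μ r) := by
    simp only [P, hL1]
    refine Finset.sum_congr rfl fun r _ => ?_
    congr 2
    funext i
    split_ifs with hi
    · rfl
    · rw [hAμ r i hi]
  have hnz : ∀ a i, ∃ v, ℓ₀ a i v ≠ 0 := by
    intro a i
    by_contra! hc
    exact hℓ₀ a i (LinearMap.ext hc)
  choose v hv using hnz
  let D : ℂ → ℂ := fun s => (Matrix.of fun y y' => x s y (w y')).det
  have hD : Differentiable ℂ D := by
    simp only [D, Matrix.det_apply, Matrix.of_apply]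
    refine Differentiable.fun_sum fun σ _ => Differentiable.const_smul ?_ _
    exact Differentiable.fun_finsetProd fun y _ => hx _ _
  let C : ℂ → ℂ := fun s => ∏ a, ∏ i, L s a i (v a i)
  have hC : Differentiable ℂ C :=
    Differentiable.fun_finsetProd fun a _ => Differentiable.fun_finsetProd fun i _ => hL _ _ _
  have key : ∀ s, (D s * C s) * evalAt (P s) f = 0 := by
    intro s
    by_cases hDs : D s = 0
    · rw [hDs, zero_mul, zero_mul]
    by_cases hCs : C s = 0
    · rw [hCs, mul_zero, zero_mul]
    have hLs : ∀ a i, L s a i ≠ 0 := by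
      intro a i h
      refine hCs (Finset.prod_eq_zero (Finset.mem_univ a)
        (Finset.prod_eq_zero (Finset.mem_univ i) ?_))
      rw [h, LinearMap.zero_apply]
    have hspan' := osculatingSpan_segreVariety k (L s) hLs
    have hli : LinearIndependent ℂ (x s) := by
      rw [Fintype.linearIndependent_iff]
      intro g hg
      refine congrFun (Matrix.eq_zero_of_vecMul_eq_zero (v := g) hDs ?_)
      funext y
      have := LinearMap.congr_fun hg (w y)
      simpa [Matrix.vecMul, dotProduct] using this
    have hgen : IsGeneralTuple k (segreVariety V) (fun a => Projectivization.mk ℂ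
        (tensorFunctional V (L s a)) (tensorFunctional_ne_zero V (L s a) (hLs a))) := by
      refine ⟨fun a => segreVariety_subset_smoothLocus ⟨_, hLs a, rfl⟩, fun z' hz' => ?_⟩
      refine (hz.2 z' hz').trans ?_
      rw [hspan, hspan']
      have h1 : Module.finrank ℂ ↥(⨆ a, osculatingTensors k (ℓ₀ a)) = Fintype.card B := by
        have := finrank_span_eq_card hBli
        rwa [Subtype.range_coe, hBspan] at this
      rw [h1, ← finrank_span_eq_card hli]
      refine Submodule.finrank_mono (Submodule.span_le.mpr ?_)
      rintro _ ⟨y, rfl⟩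
      exact tensorFunctional_mem_iSup (aB y) _ (AB y) (hAB y) fun i hi => if_neg hi
    rw [evalAt_eq_zero_of_isGeneralTuple hf hf0 hgen, mul_zero]
    rw [hspan']
    exact Submodule.sum_mem _ fun r _ => Submodule.smul_mem _ _
      (tensorFunctional_mem_iSup (a r) _ (A r) (hA r) fun i hi => if_neg hi)
  have h0 : D 0 * C 0 ≠ 0 := by
    refine mul_ne_zero ?_ ?_
    · have : (Matrix.of fun y y' : B => x 0 y (w y')) = 1 := by
        ext y y'
        rw [Matrix.of_apply, hx0, hw, Matrix.one_apply]
      simp only [D, this, Matrix.det_one]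
      exact one_ne_zero
    · refine Finset.prod_ne_zero_iff.mpr fun a _ => Finset.prod_ne_zero_iff.mpr fun i _ => ?_
      rw [hL0]
      exact hv a i
  have := eq_zero_of_mul_eq_zero_of_differentiable (hD.mul hC) (differentiable_evalAt hP f) key h0 1
  rwa [hP1] at this

end Degeneration

/-! ### The ideal of the secant varieties to the osculating varieties of Segre varieties -/

section Ideal

universe u

theorem evalAt_zero_of_mem_symPower {W : Type u} [AddCommGroup W] [Module ℂ W] {d : ℕ}
    {f : SymmetricAlgebra ℂ W} (hf : f ∈ symPower W (d + 1)) : evalAt 0 f = 0 := by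
  rw [symPower_eq_span] at hf
  induction hf using Submodule.span_induction with
  | mem f h =>
    obtain ⟨w, rfl⟩ := h
    simp [evalAt]
  | zero => exact map_zero _
  | add f g _ _ hf hg => rw [map_add, hf, hg, add_zero]
  | smul c f _ hf => rw [map_smul, hf, smul_zero]

section General

variable {m : ℕ} {V : Fin m → Type u} [∀ i, AddCommGroup (V i)] [∀ i, Module ℂ (V i)]

theorem tensorFunctional_add {i : Fin m} {ℓ ℓ₁ ℓ₂ : ∀ i, Module.Dual ℂ (V i)}
    (h : ℓ i = ℓ₁ i + ℓ₂ i) (h₁ : ∀ i' ≠ i, ℓ₁ i' = ℓ i') (h₂ : ∀ i' ≠ i, ℓ₂ i' = ℓ i') :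
    tensorFunctional V ℓ = tensorFunctional V ℓ₁ + tensorFunctional V ℓ₂ := by
  have e : ℓ = Function.update ℓ i (ℓ₁ i + ℓ₂ i) := by rw [← h, Function.update_eq_self]
  have e₁ : ℓ₁ = Function.update ℓ i (ℓ₁ i) :=
    Function.eq_update_iff.mpr ⟨rfl, fun i' hi => h₁ i' hi⟩
  have e₂ : ℓ₂ = Function.update ℓ i (ℓ₂ i) :=
    Function.eq_update_iff.mpr ⟨rfl, fun i' hi => h₂ i' hi⟩
  simp only [tensorFunctional]
  rw [e, MultilinearMap.map_update_add, map_add, ← e₁, ← e₂]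

theorem isMultiadditive_polar {d : ℕ} {f : SymmetricAlgebra ℂ (⨂[ℂ] i, V i)}
    (hf : f ∈ symPower (⨂[ℂ] i, V i) d) :
    IsMultiadditive fun ℓ : Fin d → ∀ i, Module.Dual ℂ (V i) =>
      polar (fun j => tensorFunctional V (ℓ j)) f := by
  intro j i ℓ ℓ₁ ℓ₂ h hadd
  obtain ⟨P, hP⟩ := exists_multilinear_polar hf
  simp only [← hP]
  have h1 := tensorFunctional_add hadd (fun i' hi => (h j i' (Or.inr hi)).1)
    (fun i' hi => (h j i' (Or.inr hi)).2)
  have e : (fun j => tensorFunctional V (ℓ j)) = Function.update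
      (fun j => tensorFunctional V (ℓ j)) j
        (tensorFunctional V (ℓ₁ j) + tensorFunctional V (ℓ₂ j)) := by
    rw [← h1]
    exact (Function.update_eq_self j _).symm
  have e₁ : (fun j => tensorFunctional V (ℓ₁ j)) = Function.update
      (fun j => tensorFunctional V (ℓ j)) j (tensorFunctional V (ℓ₁ j)) :=
    Function.eq_update_iff.mpr ⟨rfl, fun j' hj =>
      congrArg _ (funext fun i' => (h j' i' (Or.inl hj)).1)⟩
  have e₂ : (fun j => tensorFunctional V (ℓ₂ j)) = Function.update
      (fun j => tensorFunctional V (ℓ j)) j (tensorFunctional V (ℓ₂ j)) :=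
    Function.eq_update_iff.mpr ⟨rfl, fun j' hj =>
      congrArg _ (funext fun i' => (h j' i' (Or.inl hj)).2)⟩
  rw [e, P.map_update_add, ← e₁, ← e₂]

end General

variable {k q : ℕ} {V : Fin (2 * k + 2) → Type u} [∀ i, AddCommGroup (V i)]
  [∀ i, Module ℂ (V i)]

theorem evalAt_wedgeToSym {κ : Fin (2 * k + 2) → Type} [∀ i, Fintype (κ i)]
    (b : ∀ i, Module.Basis (κ i) ℂ (V i)) {ℓ : Fin q → ∀ i, Module.Dual ℂ (V i)}
    {p : Module.Dual ℂ (⨂[ℂ] i, V i)} (hp : p ∈ ⨆ a, osculatingTensors k (ℓ a))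
    (x : ⨂[ℂ] i, ⋀[ℂ]^(q + 1) (V i)) : evalAt p (wedgeToSym b x) = 0 := by
  classical
  suffices h : (evalAt p).toLinearMap ∘ₗ wedgeToSym (d := q + 1) b = 0 from
    LinearMap.congr_fun h x
  refine wedge_linearMap_ext fun v => ?_
  obtain ⟨N, c, a, μ, A, hA, hAμ, rfl⟩ := exists_sum_of_mem_iSup_osculatingTensors hp
  rw [LinearMap.comp_apply, wedgeToSym_tprod, LinearMap.zero_apply, map_sum]
  simp only [map_zsmul, AlgHom.toLinearMap_apply, map_prod, evalAt, SymmetricAlgebra.lift_ι_apply,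
    LinearMap.sum_apply, LinearMap.smul_apply, tensorFunctional_tprod, smul_eq_mul,
    Finset.prod_univ_sum, Fintype.piFinset_univ, Finset.smul_sum]
  rw [Finset.sum_comm]
  refine Finset.sum_eq_zero fun β _ => ?_
  simp only [Finset.prod_mul_distrib, zsmul_eq_mul, mul_left_comm _ (∏ j, c (β j))]
  rw [← Finset.mul_sum,
    sum_sign_prod_eq_prod_det fun i j' j => μ (β j) i (v i j')]
  obtain ⟨j₁, j₂, hj, hβ⟩ := Fintype.exists_ne_map_eq_of_card_lt (fun j => a (β j)) (by simp)
  have hcard : (A (β j₁) ∪ A (β j₂)).card < Fintype.card (Fin (2 * k + 2)) := by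
    have h1 := Finset.card_union_le (A (β j₁)) (A (β j₂))
    have h2 := hA (β j₁)
    have h3 := hA (β j₂)
    rw [Fintype.card_fin]
    omega
  obtain ⟨i, hi⟩ : ∃ i, i ∉ A (β j₁) ∪ A (β j₂) := by
    by_contra! hc
    rw [Finset.eq_univ_iff_forall.mpr hc, Finset.card_univ] at hcard
    exact lt_irrefl _ hcard
  rw [Finset.mem_union, not_or] at hi
  refine mul_eq_zero_of_right _ (Finset.prod_eq_zero (Finset.mem_univ i) ?_)
  refine Matrix.det_zero_of_column_eq hj fun j' => ?_
  rw [Matrix.of_apply, Matrix.of_apply, hAμ _ i hi.1, hAμ _ i hi.2]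
  exact congrArg (fun r => ℓ r i (v i j')) hβ

variable [∀ i, FiniteDimensional ℂ (V i)]

theorem polar_eq_zero_of_two_columns {f : SymmetricAlgebra ℂ (⨂[ℂ] i, V i)}
    (hf : f ∈ idealComponent (secantOsculating q k (segreVariety V)) (q + 1))
    {a b : Fin (q + 1)} {i i' : Fin (2 * k + 2)} {ℓ : Fin (q + 1) → ∀ i, Module.Dual ℂ (V i)}
    (hab : a ≠ b) (hii : i ≠ i') (h : ℓ a i = ℓ b i) (h' : ℓ a i' = ℓ b i') :
    polar (fun j => tensorFunctional V (ℓ j)) f = 0 := by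
  classical
  refine polar_eq_zero _ _ fun c => ?_
  have hf0 := evalAt_zero_of_mem_symPower hf.2
  by_cases hne : ∀ i, ∃ μ : Module.Dual ℂ (V i), μ ≠ 0
  · have hcard : ({i, i'}ᶜ : Finset (Fin (2 * k + 2))).card = 2 * k := by
      rw [Finset.card_compl, Finset.card_pair hii, Fintype.card_fin]
      omega
    obtain ⟨A, hAsub, hAcard⟩ := Finset.exists_subset_card_eq
      (show k ≤ ({i, i'}ᶜ : Finset (Fin (2 * k + 2))).card by omega)
    let z : Fin q → ∀ i, Module.Dual ℂ (V i) := fun r =>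
      if b.succAbove r = a then fun e => if e ∈ A then ℓ b e else ℓ a e else ℓ (b.succAbove r)
    obtain ⟨r₀, hr₀⟩ := Fin.exists_succAbove_eq hab
    have hz₀ : z r₀ = fun e => if e ∈ A then ℓ b e else ℓ a e := if_pos hr₀
    refine evalAt_eq_zero_of_mem_iSup hne hf.1 hf0 z _ (Submodule.sum_mem _ fun j _ =>
      Submodule.smul_mem _ _ ?_)
    by_cases hja : j = a
    · subst hja
      refine tensorFunctional_mem_iSup r₀ _ A hAcard.le fun e he => ?_
      rw [hz₀]
      exact (if_neg he).symm
    by_cases hjb : j = b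
    · subst hjb
      refine tensorFunctional_mem_iSup r₀ _ ({i, i'}ᶜ \ A) ?_ fun e he => ?_
      · rw [Finset.card_sdiff_of_subset hAsub]
        omega
      · rw [hz₀]
        by_cases heA : e ∈ A
        · exact (if_pos heA).symm
        · have he' : e = i ∨ e = i' := by
            by_contra hc
            exact he (Finset.mem_sdiff.mpr ⟨by simpa using hc, heA⟩)
          simp only [heA, if_false]
          rcases he' with rfl | rfl
          · exact h.symm
          · exact h'.symm
    · obtain ⟨r, rfl⟩ := Fin.exists_succAbove_eq hjb
      refine tensorFunctional_mem_iSup r _ ∅ (by simp) fun e _ => ?_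
      simp only [z, if_neg hja]
  · push Not at hne
    obtain ⟨e, he⟩ := hne
    have : ∀ j, tensorFunctional V (ℓ j) = 0 := fun j => by
      rw [tensorFunctional, MultilinearMap.map_coord_zero _ e (he _), map_zero]
    simp only [this, smul_zero, Finset.sum_const_zero]
    exact hf0

theorem range_wedgeToSym {κ : Fin (2 * k + 2) → Type} [∀ i, Fintype (κ i)]
    (b : ∀ i, Module.Basis (κ i) ℂ (V i)) :
    LinearMap.range (wedgeToSym (d := q + 1) b) =
      idealComponent (secantOsculating q k (segreVariety V)) (q + 1) := by
  have hm : Even (2 * k + 2) := ⟨k + 1, by ring⟩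
  refine le_antisymm ?_ fun f hf => ?_
  · rintro _ ⟨x, rfl⟩
    refine ⟨?_, wedgeToSym_mem_symPower b x⟩
    intro p hp hmem
    refine hmem _ ?_ p hp rfl
    rintro p' hp' ⟨z, hz, hle⟩
    choose ℓ hℓ hzℓ using fun a => (hz.1 a).1
    obtain rfl : z = fun a => Projectivization.mk ℂ (tensorFunctional V (ℓ a))
      (tensorFunctional_ne_zero V (ℓ a) (hℓ a)) := funext hzℓ
    rw [osculatingSpan_segreVariety k ℓ hℓ, Projectivization.submodule_mk,
      Submodule.span_singleton_le_iff_mem] at hle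
    exact evalAt_wedgeToSym b hle x
  · refine mem_range_wedgeToSym b hf.2 fun s ℓ => ?_
    have h := column_signs (G := fun ℓ : Fin (q + 1) → ∀ i, Module.Dual ℂ (V i) =>
      polar (fun j => tensorFunctional V (ℓ j)) f) (isMultiadditive_polar hf.2)
      (fun σ ℓ => polar_perm hf.2 σ fun j => tensorFunctional V (ℓ j))
      (fun _ _ _ _ ℓ hab hii h h' => polar_eq_zero_of_two_columns hf hab hii h h') hm s ℓ
    exact h

end Ideal

end SecOsc

end

theorem corollary2 (k q : ℕ) (hq : 1 ≤ q) (V : Fin (2 * k + 2) → Type*)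
    [∀ i, AddCommGroup (V i)] [∀ i, Module ℂ (V i)] [∀ i, FiniteDimensional ℂ (V i)] :
    (∀ (g : SecOsc.GLProd V),
      ∀ f ∈ SecOsc.idealComponent
          (SecOsc.secantOsculating q k (SecOsc.segreVariety V)) (q + 1),
        SecOsc.symRep V g f ∈ SecOsc.idealComponent
          (SecOsc.secantOsculating q k (SecOsc.segreVariety V)) (q + 1)) ∧
    ∃ Φ : (⨂[ℂ] i, ⋀[ℂ]^(q + 1) (V i)) →ₗ[ℂ] SymmetricAlgebra ℂ (⨂[ℂ] i, V i),
      (∀ v : ∀ i, Fin (q + 1) → V i,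
        Φ (PiTensorProduct.tprod ℂ fun i => exteriorPower.ιMulti ℂ (q + 1) (v i)) =
          ∑ s : Fin (2 * k + 2) → Equiv.Perm (Fin (q + 1)),
            (∏ i, ((Equiv.Perm.sign (s i) : ℤˣ) : ℤ)) •
              ∏ j, SymmetricAlgebra.ι ℂ (⨂[ℂ] i, V i)
                (PiTensorProduct.tprod ℂ fun i => v i (s i j))) ∧
      (∀ (g : SecOsc.GLProd V) (x : ⨂[ℂ] i, ⋀[ℂ]^(q + 1) (V i)),
        Φ (SecOsc.wedgeRep V (q + 1) g x) = SecOsc.symRep V g (Φ x)) ∧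
      Function.Injective Φ ∧
      LinearMap.range Φ = SecOsc.idealComponent
        (SecOsc.secantOsculating q k (SecOsc.segreVariety V)) (q + 1) := by
  let b := fun i => Module.finBasis ℂ (V i)
  have hrange := SecOsc.range_wedgeToSym (q := q) b
  refine ⟨fun g f hf => ?_, SecOsc.wedgeToSym b, SecOsc.wedgeToSym_tprod b,
    SecOsc.wedgeToSym_wedgeRep b, SecOsc.wedgeToSym_injective b ⟨k + 1, by ring⟩, hrange⟩
  rw [← hrange] at hf ⊢
  obtain ⟨x, rfl⟩ := hf
  exact ⟨SecOsc.wedgeRep V (q + 1) g x, SecOsc.wedgeToSym_wedgeRep b g x⟩
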